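/- **Conventions.** Let $K$ be a number field and $\overline K$ an algebraic closure. For $F=K$ or $F=\overline K$, let $M_F$ be the set of places of $F$; $|\cdot|_w$ is the absolute value of $w\in M_F$ normalised so that it extends the usual absolute value of $\mathbb Q$ or the $p$-adic one with $|p|_p=1/p$. Every $w\in M_{\overline K}$ lies above a unique $v\in M_K$ (its restriction). An *$M_K$-constant* is a family $(c_v)_{v\in M_K}$ of real numbers with $c_v=0$ for all but finitely many $v$. We put $\log 0=-\infty$, $\max\emptyset=-\infty$, $\min\emptyset=+\infty$, and an empty intersection of subsets is the whole space. If $U=\operatorname{Spec}K[U]$ is an affine $K$-scheme of finite type (e.g. an affine variety over $K$), a subset $E\subset U(\overline K)\times M_{\overline K}$ is *$M_K$-bounded* if for every $f\in\overline K[U]=\overline K\otimes_K K[U]$ there is an $M_K$-constant $(c_v)$ with $\log|f(P)|_w\le c_v$ for all $(P,w)\in E$, $w$ above $v$. Let $X$ be a projective variety over $K$ (an integral $K$-scheme that admits a closed immersion into some $\mathbb P^n_K$) and $Y\subset X$ a closed subset. A *tubular neighbourhood* of $Y$ in $X$ is a family $\mathcal V=(V_w)_{w\in M_{\overline K}}$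 of subsets of $X(\overline K)$ of the following form: for some closed embedding $X\subset\mathbb P^n_K$ over $K$, some homogeneous generators $g_1,\dots,g_s\in K[X_0,\dots,X_n]$ of the homogeneous ideal of $Y$ in $\mathbb P^n_K$ and some $M_K$-constant $(c_v)$, $V_w$ is, for every $w$ above $v$, the set of $P\in X(\overline K)$ with homogeneous coordinates $x_P$ such that $$\log|g_j(x_P)|_w<\deg(g_j)\cdot\log\max_i|x_{P,i}|_w+c_v\qquad\text{for all }j\in\{1,\dots,s\}.$$ **Proposition (Key proposition).** (a) (Affine version) Let $U$ be an affine $K$-scheme of finite type, $Y_1,\dots,Y_r$ closed subsets of $U$, and $Y=\bigcap_\ell Y_\ell$. For each $\ell$ let $g_{\ell,1},\dots,g_{\ell,s_\ell}\in K[U]$ be generators of the ideal of all functions vanishing on $Y_\ell$, and let $h_1,\dots,h_s\in K[U]$ be generators of the ideal of all functions vanishing on $Y$. For every $M_K$-bounded subset $E$ of $U(\overline K)\times M_{\overline K}$ and every $M_K$-constant $(c_{0,v})_v$ there is an $M_K$-constant $(c_v)_v$ such that for every $(P,w)\in E$, with $w$ above $v\in M_K$, $$\max_{1\le\ell\le r,\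 1\le j\le s_\ell}\log|g_{\ell,j}(P)|_w\ge c_v\qquad\text{or}\qquad\max_{1\le j\le s}\log|h_j(P)|_w<c_{0,v}.$$ (b) (Projective version) Let $X$ be a normal projective variety over $K$, let $\phi_1,\dots,\phi_r\in K(X)$, and let $Y$ be the intersection of the supports of the Weil divisors of poles of the $\phi_\ell$ (the zero function having no poles). For every tubular neighbourhood $\mathcal V=(V_w)_w$ of $Y$ in $X$ there is an $M_K$-constant $(c_v)_v$ such that for every $w\in M_{\overline K}$, above $v\in M_K$, and every $P\in X(\overline K)$, $$\min_{1\le\ell\le r}\log|\phi_\ell(P)|_w\le c_v\qquad\text{or}\qquad P\in V_w,$$ where $\log|\phi_\ell(P)|_w=+\infty$ if $\phi_\ell$ is not regular at $P$. -/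

import Mathlib

open AlgebraicGeometry CategoryTheory
open scoped TensorProduct

attribute [local instance] MvPolynomial.gradedAlgebra

universe u v

namespace TubularRunge

/-! ### Places and `M_K`-constants -/

/-- A place of a field `F` algebraic over `ℚ`, given by its normalised absolute value: the one that
extends the usual absolute value of `ℚ` or a `p`-adic absolute value of `ℚ` with `|p|_p = 1/p`. -/
def Place (F : Type*) [Field F] : Type _ :=
  {w : AbsoluteValue F ℝ // (∀ q : ℚ, w (q : F) = |(q : ℝ)|) ∨
    ∃ p : ℕ, p.Prime ∧ ∀ q : ℚ, w (q : F) = (padicNorm p q : ℝ)}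

namespace Place

variable {F : Type*} [Field F]

/-- The normalised absolute value `|·|_w`. -/
def abv (w : Place F) : AbsoluteValue F ℝ := w.1

open Classical in
/-- `log |x|_w`, with the convention `log 0 = -∞`. -/
noncomputable def logAbs (w : Place F) (x : F) : EReal :=
  if x = 0 then ⊥ else (Real.log (w.abv x) : ℝ)

/-- The place of `K` below a place `w` of an extension `F`; that `w` is above `v` means
`w.below K = v`. -/
def below (K : Type*) [Field K] [Algebra K F] (w : Place F) : Place K :=
  ⟨w.abv.comp (algebraMap K F).injective, by
    have e (q : ℚ) : w.abv.comp (algebraMap K F).injective (q : K) = w.1 (q : F) :=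
      congrArg w.1 (map_ratCast (algebraMap K F) q)
    exact w.2.imp (fun h q => (e q).trans (h q))
      (fun ⟨p, hp, h⟩ => ⟨p, hp, fun q => (e q).trans (h q)⟩)⟩

end Place

/-- An `M_K`-constant: a family of reals indexed by the places of `K`, zero outside a finite set. -/
abbrev MConstant (K : Type*) [Field K] := Place K →₀ ℝ

/-! ### The affine setting: `U = Spec A` with `A = K[U]` -/

section Affine

variable (K : Type*) [Field K] (A : Type*) [CommRing A] [Algebra K A]

/-- The geometric points `U(K̄)` of `U = Spec A`. -/
abbrev AffinePoint := A →ₐ[K] AlgebraicClosure K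

variable {K A}

/-- The value at `P ∈ U(K̄)` of a regular function in `K̄[U] = K̄ ⊗ K[U]`. -/
noncomputable def AffinePoint.eval (P : AffinePoint K A) :
    AlgebraicClosure K ⊗[K] A →ₐ[AlgebraicClosure K] AlgebraicClosure K :=
  Algebra.TensorProduct.productLeftAlgHom (AlgHom.id (AlgebraicClosure K) (AlgebraicClosure K)) P

/-- `f ∈ K̄[U]` is `M_K`-bounded on `E ⊆ U(K̄) × M_K̄`. -/
def IsMBoundedOn (E : Set (AffinePoint K A × Place (AlgebraicClosure K)))
    (f : AlgebraicClosure K ⊗[K] A) : Prop :=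
  ∃ c : MConstant K, ∀ P w, (P, w) ∈ E → w.logAbs (P.eval f) ≤ (c (w.below K) : ℝ)

/-- `E ⊆ U(K̄) × M_K̄` is an `M_K`-bounded subset of `U`. -/
def IsMBounded (E : Set (AffinePoint K A × Place (AlgebraicClosure K))) : Prop :=
  ∀ f : AlgebraicClosure K ⊗[K] A, IsMBoundedOn E f

end Affine

/-! ### Projective space and projective varieties over `K` -/

section Projective

variable (K : Type u) [Field K] (n : ℕ)

/-- The grading of `K[X₀, …, X_n]` by degree. -/
abbrev grading : ℕ → Submodule K (MvPolynomial (Fin (n + 1)) K) :=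
  MvPolynomial.homogeneousSubmodule (Fin (n + 1)) K

lemma X_mem_grading (i : Fin (n + 1)) :
    (MvPolynomial.X i : MvPolynomial (Fin (n + 1)) K) ∈ grading K n 1 :=
  (MvPolynomial.mem_homogeneousSubmodule 1 _).2 (MvPolynomial.isHomogeneous_X K i)

/-- The scheme `ℙⁿ_K = Proj K[X₀, …, X_n]`. -/
noncomputable abbrev PSpace : Scheme.{u} := Proj (grading K n)

/-- The structure morphism `ℙⁿ_K ⟶ Spec K`. -/
noncomputable def PSpace.toSpec : PSpace K n ⟶ Spec (.of K) :=
  Proj.toSpecZero (grading K n) ≫ Spec.map (CommRingCat.ofHom (algebraMap K (grading K n 0)))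

variable {K}

/-- A projective embedding of a `K`-scheme: a closed immersion of `K`-schemes into some `ℙⁿ_K`. -/
structure ProjectiveEmbedding {X : Scheme.{u}} (f : X ⟶ Spec (.of K)) where
  /-- the dimension of the projective space -/
  n : ℕ
  /-- the closed immersion -/
  ι : X ⟶ PSpace K n
  isClosedImmersion : IsClosedImmersion ι
  comp_eq : ι ≫ PSpace.toSpec K n = f

variable (K) in
/-- A projective variety over `K`: an integral `K`-scheme admitting a projective embedding. -/
structure ProjectiveVariety where
  /-- the underlying scheme -/
  X : Scheme.{u}
  /-- the structure morphism -/
  hom : X ⟶ Spec (.of K)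
  isIntegral : IsIntegral X
  projective : Nonempty (ProjectiveEmbedding hom)

namespace ProjectiveVariety

variable (V : ProjectiveVariety K)

instance : IsIntegral V.X := V.isIntegral

instance : IsLocallyNoetherian V.X := by
  obtain ⟨e⟩ := V.projective
  have := e.isClosedImmersion
  have h0 : Function.Surjective (algebraMap K (grading K e.n 0)) := by
    rintro ⟨x, hx⟩
    have hx' : x.totalDegree = 0 := by
      by_cases h : x = 0
      · simp [h]
      · exact ((MvPolynomial.mem_homogeneousSubmodule 0 x).1 hx).totalDegree h
    exact ⟨x.coeff 0, Subtype.ext (MvPolynomial.totalDegree_eq_zero_iff_eq_C.1 hx').symm⟩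
  have : IsNoetherianRing (grading K e.n 0) := isNoetherianRing_of_surjective K _ _ h0
  have : IsScalarTower K (grading K e.n 0) (MvPolynomial (Fin (e.n + 1)) K) :=
    IsScalarTower.of_algebraMap_eq (R := K) (S := grading K e.n 0) fun _ => rfl
  have : Algebra.FiniteType (grading K e.n 0) (MvPolynomial (Fin (e.n + 1)) K) :=
    Algebra.FiniteType.of_restrictScalars_finiteType K _ _
  exact LocallyOfFiniteType.isLocallyNoetherian (e.ι ≫ Proj.toSpecZero (grading K e.n))

/-- `V` is normal: all its local rings are integrally closed. -/
def IsNormal : Prop := ∀ x : V.X, IsIntegrallyClosed (V.X.presheaf.stalk x)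

/-- The function field `K(V)`. -/
noncomputable abbrev FunctionField : Type u := V.X.functionField

/-- The support of the Weil divisor of poles of `φ ∈ K(V)`: the union of the prime divisors
`closure {z}` (`z` a point of codimension one) along which `φ` has negative order. -/
def poleSupport (φ : V.FunctionField) : Set V.X :=
  ⋃ z ∈ {z : V.X | Order.coheight z = 1 ∧ Scheme.ord φ z < 0}, closure {z}

/-- The geometric points `V(K̄)`: the morphisms of `K`-schemes `Spec K̄ ⟶ V`. -/
structure Point where
  /-- the morphism -/
  hom : Spec (.of (AlgebraicClosure K)) ⟶ V.X
  comp_eq : hom ≫ V.hom = Spec.map (CommRingCat.ofHom (algebraMap K (AlgebraicClosure K)))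

variable {V}

/-- The point of the scheme `V` underlying a geometric point. -/
noncomputable def Point.pt (P : V.Point) : V.X :=
  P.hom (IsLocalRing.closedPoint (AlgebraicClosure K))

/-- The value at `P ∈ V(K̄)` of an element of the local ring of `V` at (the image of) `P`. -/
noncomputable def Point.eval (P : V.Point) : V.X.presheaf.stalk P.pt →+* AlgebraicClosure K :=
  (Scheme.stalkClosedPointTo P.hom).hom

open Classical in
/-- `log |φ(P)|_w` for `φ ∈ K(V)`: if `φ` is regular at `P`, i.e. comes from a (unique) element of
the local ring at `P`, this is computed from the value `φ(P) ∈ K̄`; otherwise it is `+∞`. -/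
noncomputable def Point.logAbs (P : V.Point) (w : Place (AlgebraicClosure K))
    (φ : V.FunctionField) : EReal :=
  if h : ∃ a : V.X.presheaf.stalk P.pt, algebraMap _ V.FunctionField a = φ then
    w.logAbs (P.eval h.choose)
  else ⊤

end ProjectiveVariety

/-! ### Homogeneous coordinates -/

section Coordinates

variable {n} {L : Type u} [Field L] [Algebra K L]

/-- For `x` with `x i ≠ 0`, evaluation `a / X_i ^ k ↦ a(x) / x_i ^ k` on the ring of functions
of the chart `D₊(X_i)` of `ℙⁿ_K`. -/
noncomputable def chartEval (x : Fin (n + 1) → L) (i : Fin (n + 1)) (hi : x i ≠ 0) :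
    HomogeneousLocalization.Away (grading K n) (MvPolynomial.X i) →+* L :=
  (IsLocalization.Away.lift (S := Localization.Away (MvPolynomial.X (R := K) i))
    (g := (MvPolynomial.aeval x : MvPolynomial (Fin (n + 1)) K →ₐ[K] L).toRingHom)
    (MvPolynomial.X i) (by simpa using hi)).comp
  (algebraMap (HomogeneousLocalization.Away (grading K n) (MvPolynomial.X i))
    (Localization.Away (MvPolynomial.X (R := K) i)))

/-- `x` is a system of homogeneous coordinates of the point `Q : Spec L ⟶ ℙⁿ_K`: in some chart
`D₊(X_i)` with `x i ≠ 0`, the point `Q` is `(x₀ / x_i, …, x_n / x_i)`. -/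
def IsCoordinates (Q : Spec (.of L) ⟶ PSpace K n) (x : Fin (n + 1) → L) : Prop :=
  ∃ (i : Fin (n + 1)) (hi : x i ≠ 0),
    Q = Spec.map (CommRingCat.ofHom (chartEval (K := K) x i hi)) ≫
      Proj.awayι (grading K n) (MvPolynomial.X i) (X_mem_grading K n i) one_pos

end Coordinates

/-! ### Tubular neighbourhoods -/

/-- The choices that define a tubular neighbourhood of `Y` in `V`: a projective embedding of `V`,
homogeneous generators `g j` of the homogeneous ideal of `Y` in `ℙⁿ_K`, an `M_K`-constant. -/
structure TubularDatum (V : ProjectiveVariety K) (Y : Set V.X) where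
  /-- the embedding -/
  emb : ProjectiveEmbedding V.hom
  /-- the number of generators -/
  s : ℕ
  /-- the generators -/
  g : Fin s → MvPolynomial (Fin (emb.n + 1)) K
  homogeneous : ∀ j, (g j).IsHomogeneous (g j).totalDegree
  span_eq : Ideal.span (Set.range g) =
    (ProjectiveSpectrum.vanishingIdeal (𝒜 := grading K emb.n) (emb.ι '' Y)).toIdeal
  /-- the `M_K`-constant -/
  c : MConstant K

/-- The tubular neighbourhood `(V_w)_w` defined by a datum: `V_w` consists of the points `P` with
`log |g_j(x_P)|_w < deg g_j · log ‖x_P‖_w + c_v` for all `j`, where `x_P` is a system of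
homogeneous coordinates of `P` and `w` is above `v`. The condition does not depend on `x_P`. -/
def TubularDatum.nhd {V : ProjectiveVariety K} {Y : Set V.X} (T : TubularDatum V Y)
    (w : Place (AlgebraicClosure K)) : Set V.Point :=
  {P | ∃ x : Fin (T.emb.n + 1) → AlgebraicClosure K, IsCoordinates (P.hom ≫ T.emb.ι) x ∧
    ∀ j, w.logAbs (MvPolynomial.aeval x (T.g j)) <
      (((T.g j).totalDegree * Real.log (⨆ i, w.abv (x i)) + T.c (w.below K) : ℝ) : EReal)}

/-- The family `W = (W_w)_w` of subsets of `V(K̄)` is a tubular neighbourhood of `Y` in `V`. -/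
def IsTubularNeighbourhood (V : ProjectiveVariety K) (Y : Set V.X)
    (W : Place (AlgebraicClosure K) → Set V.Point) : Prop :=
  ∃ T : TubularDatum V Y, W = T.nhd

end Projective

end TubularRunge

/-! Both versions are the Nullstellensatz with estimates uniform over all places. If a power of each
`h j` is a sum `∑ a j k * b j k` whose coefficients `a j k` are bounded by an `M_K`-constant, then
every `h j` is small wherever all the `b j k` are (`exists_bound_of_pow_eq_sum`). The bounds are
trivial at almost all places because a number field has finitely many archimedean places, so that
the triangle inequality costs a factor only there, and because a fixed element has absolute value
above 1 at finitely many places only (`Place.finite_one_lt_abv`).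

In the affine version the `b j k` are the generators `g l j`, whose common zero locus is `Y`; the
coefficients are regular functions, hence bounded on `E`.

In the projective version, division by the largest coordinate puts each point in a chart `X_i = 1`
with coordinates in the unit polydisc, where every polynomial over `K` is bounded. On this chart
each `φ l` has an ideal of denominators. Normality enters through an algebraic Hartogs theorem
(`exists_prime_le_isDiscreteValuationRing`, `IsNormal.mem_poleSupport`): a point where all
denominators of `φ l` vanish lies on a polar divisor of `φ l`. Hence the denominators of all the `φ
l` together have their common zeros in `Y`, and a power of each equation of `Y` is a sum `∑ b l`
with `a l = b l * φ l` (`IsNormal.exists_pow_eq_sum`). Outside the tubular neighbourhood some `b l`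
is bounded below, and there `φ l = a l / b l` is bounded above. -/

namespace TubularRunge

/-! ### Finiteness properties of places -/

namespace Place

variable {F : Type*} [Field F]

/-- An archimedean place: one that extends the usual absolute value of `ℚ`. -/
def IsArch (w : Place F) : Prop := ∀ q : ℚ, w.abv (q : F) = |(q : ℝ)|

/-- The place `w` extends the `p`-adic absolute value of `ℚ`. -/
def IsOver (p : ℕ) (w : Place F) : Prop := ∀ q : ℚ, w.abv (q : F) = (padicNorm p q : ℝ)

lemma isArch_or_isOver (w : Place F) : w.IsArch ∨ ∃ p : ℕ, p.Prime ∧ w.IsOver p := w.2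

lemma abv_below {K : Type*} [Field K] [Algebra K F] (w : Place F) (x : K) :
    (w.below K).abv x = w.abv (algebraMap K F x) := rfl

lemma isArch_below_iff {K : Type*} [Field K] [Algebra K F] (w : Place F) :
    (w.below K).IsArch ↔ w.IsArch := by
  simp [IsArch, abv_below]

/-- An absolute value that is at most 1 on the natural numbers is ultrametric, and the `p`-adic one
is. -/
lemma isNonarchimedean_of_not_isArch (w : Place F) (hw : ¬ w.IsArch) :
    IsNonarchimedean w.abv := by
  obtain ⟨p, hp, h⟩ := w.isArch_or_isOver.resolve_left hw
  have hp' : Fact p.Prime := ⟨hp⟩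
  let _ : NormedField F := w.abv.toNormedField
  have hU : IsUltrametricDist F :=
    IsUltrametricDist.isUltrametricDist_of_forall_norm_natCast_le_one fun n => by
      have h1 := h n
      have h2 : padicNorm p ((n : ℤ) : ℚ) ≤ 1 := padicNorm.of_int n
      change w.abv (n : F) ≤ 1
      push_cast at h1 h2
      rw [h1]
      exact_mod_cast h2
  intro x y
  exact IsUltrametricDist.norm_add_le_max x y

lemma logAbs_lt_iff (w : Place F) (x : F) (r : ℝ) :
    w.logAbs x < (r : EReal) ↔ w.abv x < Real.exp r := by
  unfold logAbs
  split_ifs with h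
  · simp [h, EReal.bot_lt_coe, Real.exp_pos]
  · rw [EReal.coe_lt_coe_iff, Real.log_lt_iff_lt_exp (w.abv.pos h)]

lemma logAbs_le_iff (w : Place F) (x : F) (r : ℝ) :
    w.logAbs x ≤ (r : EReal) ↔ w.abv x ≤ Real.exp r := by
  unfold logAbs
  split_ifs with h
  · simp [h, (Real.exp_pos r).le]
  · rw [EReal.coe_le_coe_iff, Real.log_le_iff_le_exp (w.abv.pos h)]

lemma le_logAbs_iff (w : Place F) (x : F) (r : ℝ) :
    (r : EReal) ≤ w.logAbs x ↔ Real.exp r ≤ w.abv x := by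
  rw [← not_lt, logAbs_lt_iff, not_lt]

/-- Finitely many absolute values extend a given nontrivial absolute value of `ℚ`. -/
lemma finite_of_forall_ratCast_eq [NumberField F] (f : ℚ → ℝ) (q₀ : ℚ) (h₀ : f q₀ ≠ 1)
    (h₀' : f q₀ ≠ 0) :
    {w : Place F | ∀ q : ℚ, w.abv (q : F) = f q}.Finite := by
  set S := {w : Place F | ∀ q : ℚ, w.abv (q : F) = f q} with hS
  have hnt : ∀ w ∈ S, w.abv.IsNontrivial := fun w hw =>
    ⟨q₀, by rintro h; apply h₀'; rw [← hw, h, map_zero], by rw [hw]; exact h₀⟩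
  have hpos : ∀ w ∈ S, 0 < f q₀ := fun w hw =>
    lt_of_le_of_ne (by rw [← hw]; exact w.abv.nonneg _) h₀'.symm
  -- Equivalent absolute values differ by an exponent, which the common value at `q₀` forces to be
  -- 1.
  have hne : ∀ w ∈ S, ∀ w' ∈ S, w ≠ w' → ¬ w.abv.IsEquiv w'.abv := by
    intro w hw w' hw' hww h
    obtain ⟨c, hc, he⟩ := AbsoluteValue.isEquiv_iff_exists_rpow_eq.1 h
    apply hww
    have h1 := congrFun he (q₀ : F)
    simp only [hw q₀, hw' q₀] at h1
    have hc1 : c = 1 := by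
      have h2 := congrArg Real.log h1
      rw [Real.log_rpow (hpos w hw)] at h2
      have h3 : Real.log (f q₀) ≠ 0 := Real.log_ne_zero_of_pos_of_ne_one (hpos w hw) h₀
      exact mul_right_cancel₀ h3 (by linarith)
    apply Subtype.ext
    ext x
    have h2 := congrFun he x
    rwa [hc1, Real.rpow_one] at h2
  by_contra hinf
  obtain ⟨T, hTS, hT⟩ := Set.Infinite.exists_subset_card_eq hinf (Module.finrank ℚ F + 1)
  -- Weak approximation: `a w` is larger than 1 at `w` and smaller than 1 at the other places of
  -- `T`. High powers of the `a w` will be independent over `ℚ`, against the choice of the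
  -- cardinality of `T`.
  obtain ⟨a, ha⟩ := Classical.axiom_of_choice
    (AbsoluteValue.exists_one_lt_lt_one_pi_of_not_isEquiv (v := fun w : T => w.1.abv)
      (fun w => hnt _ (hTS w.2))
      (fun w w' hww => hne _ (hTS w.2) _ (hTS w'.2) (fun h => hww (Subtype.ext h))))
  have key : ∃ n : ℕ, LinearIndependent ℚ (fun w : T => a w ^ n) := by
    obtain ⟨n, hn⟩ : ∃ n : ℕ, ∀ w w' : T, w' ≠ w →
        (Fintype.card T : ℝ) * w.1.abv (a w') ^ n < 1 := by
      have : ∀ᶠ n : ℕ in Filter.atTop, ∀ p : T × T, p.2 ≠ p.1 →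
          (Fintype.card T : ℝ) * p.1.1.abv (a p.2) ^ n < 1 := by
        rw [Filter.eventually_all]
        rintro ⟨w, w'⟩
        by_cases hww : w' = w
        · exact Filter.Eventually.of_forall fun n hn => absurd hww hn
        · have h1 := tendsto_pow_atTop_nhds_zero_of_lt_one (w.1.abv.nonneg (a w'))
            ((ha w').2 w (Ne.symm hww))
          have h2 := h1.const_mul (Fintype.card T : ℝ)
          rw [mul_zero] at h2
          filter_upwards [h2.eventually (gt_mem_nhds one_pos)] with n hn _ using hn
      obtain ⟨n, hn⟩ := this.exists
      exact ⟨n, fun w w' h => hn (w, w') h⟩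
    refine ⟨n, ?_⟩
    rw [Fintype.linearIndependent_iff]
    intro g hg
    by_contra! hcon
    obtain ⟨i₀, hi₀⟩ := hcon
    have : Nonempty T := ⟨i₀⟩
    -- All places of `T` induce the same `f` on `ℚ`, so the coefficient largest for `f` is largest
    -- at `w₀` too; its term then dominates the relation at `w₀`.
    obtain ⟨w₀, -, hw₀⟩ := Finset.exists_max_image Finset.univ (fun w : T => f (g w))
      ⟨i₀, Finset.mem_univ _⟩
    have hval : ∀ (w : T) (q : ℚ), w.1.abv (q : F) = f q := fun w q => hTS w.2 q
    have hgpos : 0 < f (g w₀) := by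
      refine lt_of_lt_of_le ?_ (hw₀ i₀ (Finset.mem_univ _))
      rw [← hval i₀]
      exact i₀.1.abv.pos (by exact_mod_cast hi₀)
    have hcard : (0 : ℝ) < Fintype.card T := by exact_mod_cast Fintype.card_pos
    classical
    have h1 : (g w₀ : F) * a w₀ ^ n = - ∑ w ∈ Finset.univ.erase w₀, (g w : F) * a w ^ n := by
      rw [eq_neg_iff_add_eq_zero, Finset.add_sum_erase _ (fun w => (g w : F) * a w ^ n)
        (Finset.mem_univ w₀)]
      simpa [Algebra.smul_def] using hg
    have h2 : f (g w₀) ≤ w₀.1.abv ((g w₀ : F) * a w₀ ^ n) := by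
      rw [map_mul, hval, map_pow]
      exact le_mul_of_one_le_right hgpos.le (one_le_pow₀ (ha w₀).1.le)
    have h3 : w₀.1.abv (∑ w ∈ Finset.univ.erase w₀, (g w : F) * a w ^ n) < f (g w₀) := by
      refine lt_of_le_of_lt (w₀.1.abv.sum_le _ _) ?_
      have h4 : ∀ w ∈ Finset.univ.erase w₀, w₀.1.abv ((g w : F) * a w ^ n) ≤
          f (g w₀) / Fintype.card T := by
        intro w hw
        rw [map_mul, hval, map_pow, le_div_iff₀ hcard]
        have h5 := (hn w₀ w (Finset.ne_of_mem_erase hw)).le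
        have h6 := hw₀ w (Finset.mem_univ _)
        have h7 : 0 ≤ f (g w) := by rw [← hval w]; exact w.1.abv.nonneg _
        calc f (g w) * w₀.1.abv (a w) ^ n * Fintype.card T
            = f (g w) * (Fintype.card T * w₀.1.abv (a w) ^ n) := by ring
          _ ≤ f (g w₀) * 1 := by gcongr
          _ = _ := mul_one _
      refine lt_of_le_of_lt (Finset.sum_le_card_nsmul _ _ _ h4) ?_
      rw [Finset.card_erase_of_mem (Finset.mem_univ _), nsmul_eq_mul, ← mul_div_assoc,
        div_lt_iff₀ hcard, mul_comm]
      refine mul_lt_mul_of_pos_left ?_ hgpos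
      have : 0 < Fintype.card T := Fintype.card_pos
      exact_mod_cast Nat.sub_lt this one_pos
    rw [h1, AbsoluteValue.map_neg] at h2
    exact absurd h3 (not_lt.2 h2)
  obtain ⟨n, hn⟩ := key
  have := hn.fintype_card_le_finrank
  simp [hT] at this

lemma finite_isArch [NumberField F] : {w : Place F | w.IsArch}.Finite :=
  finite_of_forall_ratCast_eq (fun q => |(q : ℝ)|) 2 (by norm_num) (by norm_num)

lemma finite_isOver [NumberField F] (p : ℕ) (hp : p.Prime) : {w : Place F | w.IsOver p}.Finite := by
  have : Fact p.Prime := ⟨hp⟩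
  have h1 : padicNorm p p = (p : ℚ)⁻¹ := padicNorm.padicNorm_p_of_prime
  refine finite_of_forall_ratCast_eq (fun q => (padicNorm p q : ℝ)) p ?_ ?_
  · simp [h1, hp.one_lt.ne']
  · simp [hp.ne_zero]

/-- If `|x| > 1`, the leading term of a monic integral equation would exceed all the others. -/
lemma abv_le_one_of_isIntegral (w : Place F) (hw : IsNonarchimedean w.abv) {x : F}
    (hx : IsIntegral ℤ x) : w.abv x ≤ 1 := by
  obtain ⟨p, hp, hpx⟩ := hx
  by_contra! hlt
  have h1 : x ^ p.natDegree = - ∑ i ∈ Finset.range p.natDegree, (p.coeff i : F) * x ^ i := by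
    rw [Polynomial.eval₂_eq_sum_range, Finset.sum_range_succ, hp.coeff_natDegree] at hpx
    simp only [map_one, one_mul, eq_intCast] at hpx
    rw [eq_neg_iff_add_eq_zero, add_comm]
    exact hpx
  rcases Nat.eq_zero_or_pos p.natDegree with h0 | h0
  · simp [h0] at h1
  · obtain ⟨i, hi, hle⟩ := IsNonarchimedean.finset_image_add_of_nonempty hw
      (fun i => (p.coeff i : F) * x ^ i) (t := Finset.range p.natDegree)
      (Finset.nonempty_range_iff.2 h0.ne')
    rw [← AbsoluteValue.map_neg, ← h1, map_pow, map_mul, map_pow] at hle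
    have h2 : w.abv (p.coeff i : F) ≤ 1 := hw.apply_intCast_le_one
    have h3 : w.abv x ^ i < w.abv x ^ p.natDegree :=
      pow_lt_pow_right₀ hlt (Finset.mem_range.1 hi)
    have h4 : w.abv (p.coeff i : F) * w.abv x ^ i ≤ 1 * w.abv x ^ i := by gcongr
    linarith

/-- Some nonzero integer multiple `d • a` is integral. At a nonarchimedean place not above a prime
divisor of `d`, `|d| = 1` and hence `|a| ≤ 1`. -/
lemma finite_one_lt_abv [NumberField F] (a : F) : {w : Place F | 1 < w.abv a}.Finite := by
  have halg : IsAlgebraic ℤ a := by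
    rw [IsFractionRing.isAlgebraic_iff ℤ ℚ F]
    exact IsAlgebraic.of_finite ℚ a
  obtain ⟨d, hd, hint⟩ := halg.exists_integral_multiple
  refine (finite_isArch.union (d.natAbs.primeFactors.finite_toSet.biUnion (t := fun p =>
    {w : Place F | p.Prime ∧ w.IsOver p}) fun p _ => ?_)).subset ?_
  · by_cases hp : p.Prime
    · simpa [hp] using finite_isOver p hp
    · simp [hp]
  · intro w hw
    by_cases harch : w.IsArch
    · exact Or.inl harch
    · obtain ⟨p, hp, hover⟩ := w.isArch_or_isOver.resolve_left harch
      refine Or.inr (Set.mem_biUnion (x := p) ?_ ⟨hp, hover⟩)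
      have hp' : Fact p.Prime := ⟨hp⟩
      by_contra hmem
      have hndvd : ¬ (p : ℤ) ∣ d := fun h => hmem (by
        rw [Finset.mem_coe, Nat.mem_primeFactors]
        exact ⟨hp, Int.natCast_dvd.1 h, Int.natAbs_ne_zero.2 hd⟩)
      have h1 : w.abv (d : F) = 1 := by
        have h2 := hover d
        rw [padicNorm.int_eq_one_iff d |>.2 hndvd] at h2
        simpa using h2
      have h3 := w.abv_le_one_of_isIntegral (w.isNonarchimedean_of_not_isArch harch) hint
      rw [zsmul_eq_mul, map_mul, h1, one_mul] at h3
      exact absurd hw (not_lt.2 h3)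

end Place

/-! ### Multiplicative constants and bounded families -/

section Bounds

variable {K : Type*} [Field K]

/-- A multiplicative `M_K`-constant which is at least `1` at every place. -/
def IsMBound (C : Place K → ℝ) : Prop := (∀ v, 1 ≤ C v) ∧ {v | C v ≠ 1}.Finite

lemma IsMBound.pos {C : Place K → ℝ} (hC : IsMBound C) (v : Place K) : 0 < C v :=
  one_pos.trans_le (hC.1 v)

lemma isMBound_one : IsMBound (fun _ : Place K => (1 : ℝ)) := ⟨fun _ => le_rfl, by simp⟩

lemma IsMBound.mul {C D : Place K → ℝ} (hC : IsMBound C) (hD : IsMBound D) :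
    IsMBound (fun v => C v * D v) := by
  refine ⟨fun v => one_le_mul_of_one_le_of_one_le (hC.1 v) (hD.1 v), (hC.2.union hD.2).subset ?_⟩
  intro v hv
  by_contra! h
  simp only [Set.mem_union, Set.mem_ofPred_eq, not_or, not_not] at h
  exact hv (by simp [h.1, h.2])

lemma IsMBound.prod {κ : Type*} (s : Finset κ) {C : κ → Place K → ℝ}
    (hC : ∀ k, IsMBound (C k)) : IsMBound (fun v => ∏ k ∈ s, C k v) := by
  classical
  induction s using Finset.induction_on with
  | empty => simpa using isMBound_one
  | insert k s hk ih =>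
    simp only [Finset.prod_insert hk]
    exact (hC k).mul ih

lemma IsMBound.pow {C : Place K → ℝ} (hC : IsMBound C) (n : ℕ) : IsMBound (fun v => C v ^ n) := by
  simpa using IsMBound.prod (Finset.range n) (fun _ => hC)

/-- All factors are at least 1. Products thus serve as common upper bounds of finitely many
constants. -/
lemma IsMBound.le_prod {κ : Type*} [Fintype κ] {C : κ → Place K → ℝ}
    (hC : ∀ k, IsMBound (C k)) (k : κ) (v : Place K) : C k v ≤ ∏ k, C k v := by
  classical
  rw [← Finset.mul_prod_erase _ _ (Finset.mem_univ k)]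
  exact le_mul_of_one_le_right ((hC k).pos v).le ((IsMBound.prod _ hC).1 v)

lemma isMBound_max_one {f : Place K → ℝ} (hf : {v | 1 < f v}.Finite) :
    IsMBound (fun v => max 1 (f v)) :=
  ⟨fun v => le_max_left _ _, hf.subset fun v hv => by
    by_contra h
    exact hv (max_eq_left (not_lt.1 h))⟩

/-- The logarithm of a multiplicative constant. -/
lemma IsMBound.exists_exp_eq {C : Place K → ℝ} (hC : IsMBound C) :
    ∃ c : MConstant K, ∀ v, Real.exp (c v) = C v := by
  classical
  refine ⟨Finsupp.onFinset hC.2.toFinset (fun v => Real.log (C v)) fun v hv => ?_, fun v => ?_⟩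
  · rw [Set.Finite.mem_toFinset, Set.mem_ofPred_eq]
    rintro h
    exact hv (by simp [h])
  · simp [Real.exp_log (hC.pos v)]

lemma exists_isMBound_le_exp (c : MConstant K) :
    ∃ C : Place K → ℝ, IsMBound C ∧ (∀ v, Real.exp (c v) ≤ C v) ∧
      ∀ v, (C v)⁻¹ ≤ Real.exp (c v) := by
  refine ⟨fun v => Real.exp |c v|, ⟨fun v => Real.one_le_exp (abs_nonneg _), ?_⟩, fun v => ?_,
    fun v => ?_⟩
  · refine c.support.finite_toSet.subset fun v hv => ?_
    rw [Finset.mem_coe, Finsupp.mem_support_iff]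
    rintro h
    exact hv (by simp [h])
  · exact Real.exp_le_exp.2 (le_abs_self _)
  · rw [← Real.exp_neg]
    exact Real.exp_le_exp.2 (neg_abs_le _)

variable {L : Type*} [Field L] [Algebra K L] {S : Type*} (pl : S → Place L)

variable (K) in
/-- A family of elements of `L`, each considered at a place of `L`, is bounded if it is bounded by
an `M_K`-constant. -/
def IsMBddFamily (f : S → L) : Prop :=
  ∃ C : Place K → ℝ, IsMBound C ∧ ∀ s, (pl s).abv (f s) ≤ C ((pl s).below K)

open Classical in
/-- The constant in the triangle inequality for `n` summands: `n` at archimedean places and `1` at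
the others. -/
noncomputable def sumConst (n : ℕ) (v : Place K) : ℝ := if v.IsArch then max 1 n else 1

lemma isMBound_sumConst [NumberField K] (n : ℕ) :
    IsMBound (sumConst n : Place K → ℝ) := by
  refine ⟨fun v => ?_, Place.finite_isArch.subset fun v hv => ?_⟩
  · unfold sumConst
    split_ifs
    exacts [le_max_left _ _, le_rfl]
  · by_contra h
    exact hv (if_neg h)

/-- The strict form is what the strict inequalities of tubular neighbourhoods need; `0 < B` covers
the empty sum. -/
lemma abv_sum_lt (w : Place L) {κ : Type*} [Fintype κ] (f : κ → L) {B : ℝ} (hB : 0 < B)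
    (hf : ∀ k, w.abv (f k) < B) :
    w.abv (∑ k, f k) < sumConst (Fintype.card κ) (w.below K) * B := by
  rcases isEmpty_or_nonempty κ with h | h
  · simpa [sumConst] using hB
  · unfold sumConst
    rw [w.isArch_below_iff]
    split_ifs with hw
    · calc w.abv (∑ k, f k) ≤ ∑ k, w.abv (f k) := w.abv.sum_le _ _
        _ < ∑ _k : κ, B := Finset.sum_lt_sum_of_nonempty Finset.univ_nonempty fun k _ => hf k
        _ = Fintype.card κ * B := by simp
        _ ≤ _ := by gcongr; exact le_max_right _ _
    · obtain ⟨k, -, hk⟩ := IsNonarchimedean.finset_image_add_of_nonempty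
        (w.isNonarchimedean_of_not_isArch hw) f (Finset.univ_nonempty (α := κ))
      rw [one_mul]
      exact hk.trans_lt (hf k)

variable {pl}

lemma IsMBddFamily.mul {f g : S → L} (hf : IsMBddFamily K pl f) (hg : IsMBddFamily K pl g) :
    IsMBddFamily K pl (fun s => f s * g s) := by
  obtain ⟨C, hC, h⟩ := hf
  obtain ⟨D, hD, h'⟩ := hg
  refine ⟨_, hC.mul hD, fun s => ?_⟩
  rw [map_mul]
  exact mul_le_mul (h s) (h' s) ((pl s).abv.nonneg _) (hC.pos _).le

lemma IsMBddFamily.add [NumberField K] {f g : S → L} (hf : IsMBddFamily K pl f)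
    (hg : IsMBddFamily K pl g) : IsMBddFamily K pl (fun s => f s + g s) := by
  obtain ⟨C, hC, h⟩ := hf
  obtain ⟨D, hD, h'⟩ := hg
  refine ⟨_, (isMBound_sumConst 2).mul (hC.mul hD), fun s => ?_⟩
  set v := (pl s).below K
  have hT := (isMBound_sumConst (K := K) 2).pos v
  -- The sum estimate is strict, so the bound is enlarged by `ε / sumConst 2 v` and `ε` tends to 0.
  refine le_of_forall_pos_lt_add fun ε hε => ?_
  have hlt : C v * D v < C v * D v + ε / sumConst 2 v := lt_add_of_pos_right _ (div_pos hε hT)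
  have h1 := abv_sum_lt (K := K) (pl s) ![f s, g s] (B := C v * D v + ε / sumConst 2 v)
    ((mul_pos (hC.pos v) (hD.pos v)).trans hlt) (fun k => by
      fin_cases k
      · exact ((h s).trans (le_mul_of_one_le_right (hC.pos v).le (hD.1 v))).trans_lt hlt
      · exact ((h' s).trans (le_mul_of_one_le_left (hD.pos v).le (hC.1 v))).trans_lt hlt)
  rw [Fin.sum_univ_two, Fintype.card_fin, mul_add, mul_div_cancel₀ _ hT.ne'] at h1
  exact h1

lemma isMBddFamily_algebraMap [NumberField K] (a : K) :
    IsMBddFamily K pl (fun _ => algebraMap K L a) :=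
  ⟨_, isMBound_max_one (Place.finite_one_lt_abv a), fun _ => le_max_right _ _⟩

lemma isMBddFamily_of_le_one {f : S → L} (h : ∀ s, (pl s).abv (f s) ≤ 1) :
    IsMBddFamily K pl f := ⟨_, isMBound_one, h⟩

lemma isMBddFamily_aeval [NumberField K] {σ : Type*} {x : S → σ → L}
    (hx : ∀ i, IsMBddFamily K pl (fun s => x s i)) (p : MvPolynomial σ K) :
    IsMBddFamily K pl (fun s => MvPolynomial.aeval (x s) p) := by
  induction p using MvPolynomial.induction_on with
  | C a => simpa using isMBddFamily_algebraMap a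
  | add p q hp hq => simpa using hp.add hq
  | mul_X p i hp => simpa using hp.mul (hx i)

/-- If a power of each `h j` is a combination of the `b k` with bounded coefficients, then the
`h j` are small wherever all the `b k` are small. -/
lemma exists_bound_of_pow_eq_sum [NumberField K] {κ κ' : Type*} [Fintype κ] [Fintype κ']
    (h : κ' → S → L) (N : κ' → ℕ) (a b : κ' → κ → S → L)
    (ha : ∀ j k, IsMBddFamily K pl (a j k))
    (heq : ∀ j s, h j s ^ N j = ∑ k, a j k s * b j k s)
    {C₀ : Place K → ℝ} (hC₀ : IsMBound C₀) :
    ∃ C : Place K → ℝ, IsMBound C ∧ ∀ s,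
      (∃ j k, (C ((pl s).below K))⁻¹ ≤ (pl s).abv (b j k s)) ∨
        ∀ j, (pl s).abv (h j s) < (C₀ ((pl s).below K))⁻¹ := by
  choose A hA hA' using ha
  have hA1 : ∀ j, IsMBound (fun v => ∏ k, A j k v) := fun j => IsMBound.prod _ (hA j)
  have hD : ∀ j, IsMBound (fun v => sumConst (Fintype.card κ) v * (∏ k, A j k v) * C₀ v ^ N j) :=
    fun j => ((isMBound_sumConst _).mul (hA1 j)).mul (hC₀.pow _)
  -- With `E` the product over `j` of `sumConst * ∏ A * C₀ ^ N j`, the bounds `|b j k| < E⁻¹` give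
  -- `|h j| ^ N j < sumConst * ∏ A * E⁻¹ ≤ C₀⁻¹ ^ N j`.
  refine ⟨_, IsMBound.prod Finset.univ hD, fun s => ?_⟩
  set v := (pl s).below K with hv
  by_contra! hcon
  obtain ⟨hb, j, hj⟩ := hcon
  set E := ∏ j, sumConst (Fintype.card κ) v * (∏ k, A j k v) * C₀ v ^ N j with hE
  have hEpos : 0 < E := (IsMBound.prod Finset.univ hD).pos v
  have hApos := (hA1 j).pos v
  have hspos := (isMBound_sumConst (K := K) (Fintype.card κ)).pos v
  have hCpos := hC₀.pos v
  have h1 : ∀ k, (pl s).abv (a j k s * b j k s) < (∏ k, A j k v) * E⁻¹ := fun k => by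
    rw [map_mul]
    calc (pl s).abv (a j k s) * (pl s).abv (b j k s)
        ≤ (∏ k, A j k v) * (pl s).abv (b j k s) :=
          mul_le_mul_of_nonneg_right ((hA' j k s).trans (IsMBound.le_prod (hA j) k v))
            ((pl s).abv.nonneg _)
      _ < _ := mul_lt_mul_of_pos_left (hb j k) hApos
  have h2 := abv_sum_lt (K := K) (pl s) _ (mul_pos hApos (inv_pos.2 hEpos)) h1
  rw [← heq, map_pow, ← hv] at h2
  have h3 : sumConst (Fintype.card κ) v * (∏ k, A j k v) * C₀ v ^ N j ≤ E :=
    IsMBound.le_prod hD j v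
  have h4 : (C₀ v)⁻¹ ^ N j ≤ (pl s).abv (h j s) ^ N j := by gcongr
  have h5 := h4.trans_lt h2
  rw [inv_pow, inv_lt_iff_one_lt_mul₀ (pow_pos hCpos _)] at h5
  have h6 : C₀ v ^ N j * (sumConst (Fintype.card κ) v * ((∏ k, A j k v) * E⁻¹)) ≤ 1 := by
    rw [← div_le_one hEpos] at h3
    calc _ = _ := by ring
      _ ≤ 1 := h3
  linarith

end Bounds

/-! ### The affine version -/

section Affine

variable {K : Type*} [Field K] {A : Type*} [CommRing A] [Algebra K A]

lemma AffinePoint.eval_one_tmul (P : AffinePoint K A) (a : A) : P.eval (1 ⊗ₜ a) = P a := by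
  simp [AffinePoint.eval]

lemma IsMBounded.isMBddFamily {E : Set (AffinePoint K A × Place (AlgebraicClosure K))}
    (hE : IsMBounded E) (a : A) :
    IsMBddFamily K (fun s : E => s.1.2) (fun s => s.1.1 a) := by
  obtain ⟨c, hc⟩ := hE (1 ⊗ₜ a)
  obtain ⟨C, hC, hle, -⟩ := exists_isMBound_le_exp c
  refine ⟨C, hC, fun s => ?_⟩
  have h := hc s.1.1 s.1.2 s.2
  rw [AffinePoint.eval_one_tmul, Place.logAbs_le_iff] at h
  exact h.trans (hle _)

/-- The common zero locus of all the `g l j` is contained in `⋂ l, Y l`, so each `h j` lies in the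
radical of the ideal they generate. -/
theorem affine_dichotomy [NumberField K] (r : ℕ) (Y : Fin r → Set (PrimeSpectrum A))
    (hY : ∀ l, IsClosed (Y l)) (s : Fin r → ℕ) (g : (l : Fin r) → Fin (s l) → A)
    (hg : ∀ l, Ideal.span (Set.range (g l)) = PrimeSpectrum.vanishingIdeal (Y l))
    (t : ℕ) (h : Fin t → A)
    (hh : Ideal.span (Set.range h) = PrimeSpectrum.vanishingIdeal (⋂ l, Y l))
    (E : Set (AffinePoint K A × Place (AlgebraicClosure K)))
    (hE : IsMBounded E) (c₀ : MConstant K) :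
    ∃ c : MConstant K, ∀ (P : AffinePoint K A) (w : Place (AlgebraicClosure K)), (P, w) ∈ E →
      ((c (w.below K) : ℝ) : EReal) ≤ (⨆ l, ⨆ j, w.logAbs (P (g l j))) ∨
        (⨆ j, w.logAbs (P (h j))) < ((c₀ (w.below K) : ℝ) : EReal) := by
  have hrad : ∀ j, h j ∈
      (Ideal.span (Set.range fun k : (Σ l, Fin (s l)) => g k.1 k.2)).radical := by
    intro j
    rw [← PrimeSpectrum.vanishingIdeal_zeroLocus_eq_radical]
    have h1 : h j ∈ PrimeSpectrum.vanishingIdeal (⋂ l, Y l) :=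
      hh ▸ Ideal.subset_span ⟨j, rfl⟩
    refine PrimeSpectrum.vanishingIdeal_anti_mono ?_ h1
    intro x hx
    rw [PrimeSpectrum.zeroLocus_span, PrimeSpectrum.mem_zeroLocus] at hx
    refine Set.mem_iInter.2 fun l => ?_
    rw [← (hY l).closure_eq, ← PrimeSpectrum.zeroLocus_vanishingIdeal_eq_closure, ← hg l,
      PrimeSpectrum.zeroLocus_span, PrimeSpectrum.mem_zeroLocus]
    rintro _ ⟨k, rfl⟩
    exact hx ⟨⟨l, k⟩, rfl⟩
  choose N hN using hrad
  simp only [Ideal.mem_span_range_iff_exists_fun] at hN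
  choose a ha using hN
  obtain ⟨C₀, hC₀, -, hC₀'⟩ := exists_isMBound_le_exp c₀
  obtain ⟨C, hC, hd⟩ := exists_bound_of_pow_eq_sum (K := K) (pl := fun s : E => s.1.2)
    (fun j s => s.1.1 (h j)) N (fun j k s => s.1.1 (a j k)) (fun _ k s => s.1.1 (g k.1 k.2))
    (fun j k => hE.isMBddFamily (a j k))
    (fun j s => by rw [← map_pow, ← ha, map_sum]; simp only [map_mul]) hC₀
  obtain ⟨c, hc⟩ := hC.exists_exp_eq
  refine ⟨-c, fun P w hPw => (hd ⟨(P, w), hPw⟩).imp ?_ ?_⟩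
  · rintro ⟨_, k, hk⟩
    refine le_trans ?_ (le_iSup₂ (f := fun l j => w.logAbs (P (g l j))) k.1 k.2)
    rw [Place.le_logAbs_iff, Finsupp.neg_apply, Real.exp_neg, hc]
    exact hk
  · intro hj
    -- A finite supremum preserves the strict bound; for `t = 0` it is `⊥`.
    rw [← Finset.sup_univ_eq_iSup, Finset.sup_lt_iff (EReal.bot_lt_coe _)]
    intro j _
    rw [Place.logAbs_lt_iff]
    exact (hj j).trans_le (hC₀' _)

end Affine

/-! ### Regular functions outside the poles -/

section Hartogs

/-- If all denominators of an element `φ` of the fraction field of a noetherian domain `R` lie in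
the prime `q`, then `q` contains a prime which is the conductor of a multiple of `φ`. -/
theorem exists_prime_le_of_denominators_le {R F : Type*} [CommRing R]
    [IsNoetherianRing R] [Field F] [Algebra R F] (φ : F)
    (q : Ideal R) [q.IsPrime]
    (hq : ∀ a : R, (∃ b : R, algebraMap R F b = algebraMap R F a * φ) → a ∈ q) :
    ∃ p : Ideal R, p.IsPrime ∧ p ≤ q ∧ ∃ c : R, ∀ a : R, a ∈ p ↔
      ∃ b : R, algebraMap R F b = algebraMap R F a * (algebraMap R F c * φ) := by
  -- The denominators of `φ` are the annihilator of its class in `F / R`. A prime minimal over the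
  -- annihilator of this cyclic module is an associated prime, that is, the annihilator of some `c •
  -- m`.
  let M := F ⧸ LinearMap.range (Algebra.linearMap R F)
  let m : M := Submodule.Quotient.mk φ
  have hmem : ∀ (a : R) (x : F), a • (Submodule.Quotient.mk x : M) = 0 ↔
      ∃ b : R, algebraMap R F b = algebraMap R F a * x := by
    intro a x
    rw [← Submodule.Quotient.mk_smul, Submodule.Quotient.mk_eq_zero, LinearMap.mem_range,
      Algebra.smul_def]
    rfl
  have hle : Module.annihilator R (Submodule.span R {m}) ≤ q := by
    intro a ha
    apply hq
    rw [← hmem]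
    exact (Submodule.mem_annihilator_span_singleton m a).1 ha
  obtain ⟨p, hp, hpq⟩ := Ideal.exists_minimalPrimes_le hle
  obtain ⟨hprime, x, hx⟩ := (Submodule.isAssociatedPrime_iff).1
    (Module.associatedPrimes.minimalPrimes_annihilator_subset_associatedPrimes R _ hp)
  obtain ⟨c, hc⟩ := Submodule.mem_span_singleton.1 x.2
  refine ⟨p, hprime, hpq, c, fun a => ?_⟩
  rw [← hmem, ← Algebra.smul_def, Submodule.Quotient.mk_smul, hx, Submodule.mem_colon_singleton,
    Submodule.mem_bot, ← Subtype.coe_inj]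
  change a • (x : M) = 0 ↔ a • c • m = 0
  rw [hc]

/-- A noetherian integrally closed local domain whose maximal ideal is the conductor of a
non-integral element is a discrete valuation ring. -/
theorem isDiscreteValuationRing_of_conductor {R F : Type*} [CommRing R] [IsDomain R]
    [IsLocalRing R] [IsNoetherianRing R] [IsIntegrallyClosed R] [Field F] [Algebra R F]
    [IsFractionRing R F] (ψ : F)
    (h : ∀ a ∈ IsLocalRing.maximalIdeal R, ∃ b : R, algebraMap R F b = algebraMap R F a * ψ)
    (hψ : ¬ ∃ b : R, algebraMap R F b = ψ) :
    IsDiscreteValuationRing R := by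
  have hfield : ¬ IsField R := fun hR =>
    hψ ((IsFractionRing.surjective_iff_isField (K := F)).2 hR ψ)
  have hbot : IsLocalRing.maximalIdeal R ≠ ⊥ := fun hb =>
    hfield (IsLocalRing.isField_iff_maximalIdeal_eq.2 hb)
  have hinj := IsFractionRing.injective R F
  refine ((IsDiscreteValuationRing.TFAE R hfield).out 0 4).2 ?_
  -- If `ψ` maps the maximal ideal into itself, it is integral by the determinant trick, hence in
  -- `R`. Otherwise `t * ψ = u` is a unit for some `t`, and `t` generates the maximal ideal.
  by_cases hcase : ∀ a ∈ IsLocalRing.maximalIdeal R, ∃ b ∈ IsLocalRing.maximalIdeal R,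
      algebraMap R F b = algebraMap R F a * ψ
  · refine absurd ?_ hψ
    refine IsIntegrallyClosed.algebraMap_eq_of_integral
      (isIntegral_of_smul_mem_submodule
        (Submodule.map (Algebra.linearMap R F) (IsLocalRing.maximalIdeal R)) ?_ ?_ ψ ?_)
    · obtain ⟨a, ha, ha0⟩ := Submodule.exists_mem_ne_zero_of_ne_bot hbot
      rw [Submodule.ne_bot_iff]
      exact ⟨_, ⟨a, ha, rfl⟩, (map_ne_zero_iff _ hinj).2 ha0⟩
    · exact Submodule.FG.map _ (IsNoetherian.noetherian _)
    · rintro _ ⟨a, ha, rfl⟩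
      obtain ⟨b, hb, hba⟩ := hcase a ha
      exact ⟨b, hb, by rw [smul_eq_mul, mul_comm]; exact hba⟩
  · push Not at hcase
    obtain ⟨t, ht, htb⟩ := hcase
    obtain ⟨u, hu⟩ := h t ht
    have hunit : IsUnit u := by
      by_contra hcon
      exact htb u ((IsLocalRing.mem_maximalIdeal u).2 hcon) hu
    refine ⟨t, le_antisymm (fun x hx => ?_) (by simpa [Ideal.span_singleton_le_iff_mem] using ht)⟩
    obtain ⟨b, hb⟩ := h x hx
    obtain ⟨v, hv⟩ := hunit.exists_right_inv
    refine Ideal.mem_span_singleton.2 ⟨b * v, hinj ?_⟩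
    calc algebraMap R F x = algebraMap R F x * algebraMap R F (u * v) := by rw [hv]; simp
      _ = algebraMap R F t * (algebraMap R F x * ψ) * algebraMap R F v := by
          rw [map_mul, hu]; ring
      _ = algebraMap R F (t * (b * v)) := by rw [← hb]; simp only [map_mul]; ring

/-- A form of Hartogs' theorem for a noetherian domain: if all denominators of `φ` lie in the prime
`q`, then `q` contains a prime `p` with `φ ∉ R_p` such that `R_p` is a discrete valuation ring as
soon as it is integrally closed. -/
theorem exists_prime_le_isDiscreteValuationRing {R F : Type*} [CommRing R] [IsDomain R]
    [IsNoetherianRing R] [Field F] [Algebra R F] [IsFractionRing R F] (φ : F)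
    (q : Ideal R) [q.IsPrime]
    (hq : ∀ a : R, (∃ b : R, algebraMap R F b = algebraMap R F a * φ) → a ∈ q) :
    ∃ (p : Ideal R) (_ : p.IsPrime), p ≤ q ∧ ∀ (S : Type _) [CommRing S] [IsDomain S]
      [Algebra R S] [IsLocalization.AtPrime S p] [Algebra S F] [IsScalarTower R S F]
      [IsFractionRing S F] [IsLocalRing S] [IsIntegrallyClosed S],
      IsDiscreteValuationRing S ∧ ¬ ∃ b : S, algebraMap S F b = φ := by
  obtain ⟨p, hp, hpq, c, hc⟩ := exists_prime_le_of_denominators_le φ q hq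
  refine ⟨p, hp, hpq, fun S => ?_⟩
  intro _ _ _ _ _ _ _ _ _
  have hnoeth : IsNoetherianRing S := IsLocalization.isNoetherianRing p.primeCompl S inferInstance
  have hRS : ∀ a : R, algebraMap S F (algebraMap R S a) = algebraMap R F a := fun a =>
    (IsScalarTower.algebraMap_apply R S F a).symm
  have hψ : ¬ ∃ b : S, algebraMap S F b = algebraMap R F c * φ := by
    rintro ⟨b, hb⟩
    obtain ⟨⟨y, s⟩, hy⟩ := IsLocalization.surj p.primeCompl b
    refine s.2 ((hc s).2 ⟨y, ?_⟩)
    rw [← hb, ← hRS, ← hRS, ← hy, map_mul, mul_comm]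
  refine ⟨isDiscreteValuationRing_of_conductor (algebraMap R F c * φ) (fun a ha => ?_) hψ, ?_⟩
  · obtain ⟨⟨x, s⟩, hx⟩ := IsLocalization.surj p.primeCompl a
    have hxp : x ∈ p := by
      rw [← IsLocalization.AtPrime.to_map_mem_maximal_iff S p, ← hx]
      exact Ideal.mul_mem_right _ _ ha
    obtain ⟨y, hy⟩ := (hc x).1 hxp
    obtain ⟨v, hv⟩ := (IsLocalization.map_units S s).exists_right_inv
    refine ⟨algebraMap R S y * v, ?_⟩
    calc algebraMap S F (algebraMap R S y * v)
        = algebraMap S F (algebraMap R S x) * (algebraMap R F c * φ) * algebraMap S F v := by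
          rw [map_mul, hRS, hy, hRS]
      _ = algebraMap S F a * (algebraMap R F c * φ) * algebraMap S F (algebraMap R S s * v) := by
          rw [← hx]; simp only [map_mul]; ring
      _ = _ := by rw [hv]; simp
  · rintro ⟨b, hb⟩
    exact hψ ⟨algebraMap R S c * b, by rw [map_mul, hRS, hb]⟩

end Hartogs

/-! ### Homogeneous coordinates -/

section Coordinates

variable (K : Type u) [Field K] {n : ℕ}

/-- The dehomogenisation map `K[X₀, …, X_n] → K[D₊(X_i)]`, `X_j ↦ X_j / X_i`. -/
noncomputable def dehomogenize (i : Fin (n + 1)) : MvPolynomial (Fin (n + 1)) K →+*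
    HomogeneousLocalization.Away (grading K n) (MvPolynomial.X i) :=
  MvPolynomial.eval₂Hom
    ((HomogeneousLocalization.fromZeroRingHom (grading K n) _).comp
      (algebraMap K (grading K n 0)))
    (fun j => HomogeneousLocalization.Away.mk (grading K n) (X_mem_grading K n i) 1
      (MvPolynomial.X j) (by simpa using X_mem_grading K n j))

variable {K}

lemma eval₂_mul_right {T : Type*} [CommRing T] {σ : Type*} {R : Type*} [CommRing R] (φ : R →+* T)
    (y : σ → T) (u : T) {d : ℕ} {f : MvPolynomial σ R} (hf : f.IsHomogeneous d) :
    MvPolynomial.eval₂ φ (fun j => y j * u) f = MvPolynomial.eval₂ φ y f * u ^ d := by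
  rw [MvPolynomial.eval₂_eq, MvPolynomial.eval₂_eq, Finset.sum_mul]
  refine Finset.sum_congr rfl fun m hm => ?_
  have h := hf (MvPolynomial.mem_support_iff.1 hm)
  replace h : m.degree = d := by rw [← h, Finsupp.degree_eq_weight_one]; rfl
  rw [Finsupp.degree_apply] at h
  simp_rw [mul_pow, Finset.prod_mul_distrib, Finset.prod_pow_eq_pow_sum]
  rw [← h, mul_assoc]

variable (K) in
/-- The map `X_j ↦ X_j / X_i` into the localisation of the polynomial ring. -/
noncomputable def dehomogenizeLoc (i : Fin (n + 1)) : MvPolynomial (Fin (n + 1)) K →+*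
    Localization.Away (MvPolynomial.X i : MvPolynomial (Fin (n + 1)) K) :=
  MvPolynomial.eval₂Hom
    ((algebraMap (MvPolynomial (Fin (n + 1)) K)
      (Localization.Away (MvPolynomial.X i : MvPolynomial (Fin (n + 1)) K))).comp MvPolynomial.C)
    (fun j => algebraMap (MvPolynomial (Fin (n + 1)) K)
      (Localization.Away (MvPolynomial.X i : MvPolynomial (Fin (n + 1)) K)) (MvPolynomial.X j) *
        IsLocalization.Away.invSelf (MvPolynomial.X (R := K) i))

/-- Identities in the degree-zero part can be checked in the full localisation, where `X_j / X_i` is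
an honest product. -/
lemma val_dehomogenize (i : Fin (n + 1)) (f : MvPolynomial (Fin (n + 1)) K) :
    (dehomogenize K i f).val = dehomogenizeLoc K i f := by
  have : (algebraMap (HomogeneousLocalization.Away (grading K n) (MvPolynomial.X i))
      (Localization.Away (MvPolynomial.X (R := K) i))).comp (dehomogenize K i) =
      dehomogenizeLoc K i := by
    refine MvPolynomial.ringHom_ext (fun a => ?_) (fun j => ?_)
    · rw [RingHom.comp_apply, dehomogenize, dehomogenizeLoc, MvPolynomial.eval₂Hom_C,
        MvPolynomial.eval₂Hom_C]
      exact Localization.mk_one_eq_algebraMap (M := Submonoid.powers (MvPolynomial.X i))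
        (MvPolynomial.C a)
    · rw [RingHom.comp_apply, dehomogenize, dehomogenizeLoc, MvPolynomial.eval₂Hom_X',
        MvPolynomial.eval₂Hom_X',
        HomogeneousLocalization.algebraMap_apply, HomogeneousLocalization.Away.val_mk,
        ← Localization.mk_one_eq_algebraMap, IsLocalization.Away.invSelf,
        ← Localization.mk_eq_mk', Localization.mk_mul]
      simp
  exact DFunLike.congr_fun this f

lemma dehomogenize_of_mem (i : Fin (n + 1)) (d : ℕ) (f : MvPolynomial (Fin (n + 1)) K)
    (hf : f ∈ grading K n (d • 1)) :
    dehomogenize K i f =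
      HomogeneousLocalization.Away.mk (grading K n) (X_mem_grading K n i) d f hf := by
  have hf' : f.IsHomogeneous d := by
    simpa using (MvPolynomial.mem_homogeneousSubmodule _ f).1 hf
  apply HomogeneousLocalization.val_injective
  have h1 := MvPolynomial.eval₂_comp_left (algebraMap (MvPolynomial (Fin (n + 1)) K)
    (Localization.Away (MvPolynomial.X i : MvPolynomial (Fin (n + 1)) K)))
    MvPolynomial.C MvPolynomial.X f
  rw [MvPolynomial.eval₂_eta] at h1
  rw [val_dehomogenize, dehomogenizeLoc, MvPolynomial.coe_eval₂Hom, eval₂_mul_right _ _ _ hf',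
    HomogeneousLocalization.Away.val_mk, Localization.mk_eq_mk', IsLocalization.eq_mk'_iff_mul_eq]
  refine Eq.trans ?_ h1.symm
  rw [mul_assoc, map_pow, ← mul_pow, mul_comm (IsLocalization.Away.invSelf _),
    IsLocalization.Away.mul_invSelf, one_pow, mul_one]
  rfl

lemma dehomogenize_surjective (i : Fin (n + 1)) :
    Function.Surjective (dehomogenize K (n := n) i) := fun a => by
  obtain ⟨d, f, hf, rfl⟩ :=
    HomogeneousLocalization.Away.mk_surjective (grading K n) (X_mem_grading K n i) a
  exact ⟨f, dehomogenize_of_mem i d f hf⟩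

variable {L : Type u} [Field L] [Algebra K L]

/-- Evaluation at `x` on the ring of functions of `D₊(f)`, where `f(x) ≠ 0`. -/
noncomputable def awayEval (x : Fin (n + 1) → L) (f : MvPolynomial (Fin (n + 1)) K)
    (hf : MvPolynomial.aeval x f ≠ 0) :
    HomogeneousLocalization.Away (grading K n) f →+* L :=
  (IsLocalization.Away.lift (S := Localization.Away f)
    (g := (MvPolynomial.aeval x : MvPolynomial (Fin (n + 1)) K →ₐ[K] L).toRingHom)
    f (by simpa using hf)).comp
  (algebraMap (HomogeneousLocalization.Away (grading K n) f) (Localization.Away f))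

lemma chartEval_eq_awayEval (x : Fin (n + 1) → L) (i : Fin (n + 1)) (hi : x i ≠ 0) :
    chartEval (K := K) x i hi = awayEval x (MvPolynomial.X i) (by simpa using hi) := rfl

/-- Compatibility of evaluation with the restriction from `D₊(f)` to `D₊(f * g)`, used to compare
charts. -/
lemma awayEval_comp_awayMap (x : Fin (n + 1) → L) (f g : MvPolynomial (Fin (n + 1)) K) {e : ℕ}
    (hg : g ∈ grading K n e) (h : MvPolynomial (Fin (n + 1)) K) (hh : h = f * g)
    (hf : MvPolynomial.aeval x f ≠ 0) (hfg : MvPolynomial.aeval x h ≠ 0) :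
    (awayEval x h hfg).comp (HomogeneousLocalization.awayMap (grading K n) hg hh) =
      awayEval x f hf := by
  ext a
  simp only [awayEval, RingHom.comp_apply, HomogeneousLocalization.algebraMap_apply,
    HomogeneousLocalization.val_awayMap]
  rw [← RingHom.comp_apply]
  congr 1
  refine IsLocalization.ringHom_ext (Submonoid.powers f) ?_
  ext a <;> simp [Localization.awayLift]

lemma chartEval_dehomogenize (x : Fin (n + 1) → L) (i : Fin (n + 1)) (hi : x i ≠ 0)
    (f : MvPolynomial (Fin (n + 1)) K) :
    chartEval (K := K) x i hi (dehomogenize K i f) =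
      MvPolynomial.aeval (fun j => x j / x i) f := by
  have : (chartEval (K := K) x i hi).comp (dehomogenize K i) =
      (MvPolynomial.aeval (fun j => x j / x i) : MvPolynomial (Fin (n + 1)) K →ₐ[K] L).toRingHom := by
    refine MvPolynomial.ringHom_ext (fun a => ?_) (fun j => ?_)
    · have h1 : algebraMap (HomogeneousLocalization.Away (grading K n) (MvPolynomial.X i))
          (Localization.Away (MvPolynomial.X (R := K) i)) (dehomogenize K i (MvPolynomial.C a)) =
          algebraMap (MvPolynomial (Fin (n + 1)) K) _ (MvPolynomial.C a) := by
        rw [HomogeneousLocalization.algebraMap_apply, val_dehomogenize, dehomogenizeLoc,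
          MvPolynomial.eval₂Hom_C, RingHom.comp_apply]
      simp [chartEval, h1, -HomogeneousLocalization.algebraMap_apply]
    · have h1 : algebraMap (HomogeneousLocalization.Away (grading K n) (MvPolynomial.X i))
          (Localization.Away (MvPolynomial.X (R := K) i)) (dehomogenize K i (MvPolynomial.X j)) *
            algebraMap (MvPolynomial (Fin (n + 1)) K) _ (MvPolynomial.X i) =
          algebraMap (MvPolynomial (Fin (n + 1)) K) _ (MvPolynomial.X j) := by
        rw [HomogeneousLocalization.algebraMap_apply, val_dehomogenize, dehomogenizeLoc,
          MvPolynomial.eval₂Hom_X', mul_assoc, mul_comm (IsLocalization.Away.invSelf _),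
          IsLocalization.Away.mul_invSelf, mul_one]
      have h2 := congrArg (IsLocalization.Away.lift (S := Localization.Away (MvPolynomial.X (R := K) i))
        (g := (MvPolynomial.aeval x : MvPolynomial (Fin (n + 1)) K →ₐ[K] L).toRingHom)
        (MvPolynomial.X i) (by simpa using hi)) h1
      rw [map_mul, IsLocalization.Away.lift_eq, IsLocalization.Away.lift_eq] at h2
      simp only [AlgHom.toRingHom_eq_coe, RingHom.coe_coe, MvPolynomial.aeval_X] at h2 ⊢
      rw [eq_div_iff hi]
      exact h2
  exact DFunLike.congr_fun this f

lemma chartEval_div (x : Fin (n + 1) → L) (i : Fin (n + 1)) (hi : x i ≠ 0) :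
    chartEval (K := K) (fun j => x j / x i) i (by simp [hi]) = chartEval x i hi := by
  ext a
  obtain ⟨f, rfl⟩ := dehomogenize_surjective i a
  simp [chartEval_dehomogenize, hi]

/-- Both morphisms factor through evaluation on the overlap `D₊(X_i * X_j)`. -/
lemma chart_eq_chart (x : Fin (n + 1) → L) (i j : Fin (n + 1)) (hi : x i ≠ 0) (hj : x j ≠ 0) :
    Spec.map (CommRingCat.ofHom (chartEval (K := K) x i hi)) ≫
      Proj.awayι (grading K n) (MvPolynomial.X i) (X_mem_grading K n i) one_pos =
    Spec.map (CommRingCat.ofHom (chartEval (K := K) x j hj)) ≫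
      Proj.awayι (grading K n) (MvPolynomial.X j) (X_mem_grading K n j) one_pos := by
  have hij : MvPolynomial.aeval x (MvPolynomial.X i * MvPolynomial.X j :
    MvPolynomial (Fin (n + 1)) K) ≠ 0 := by simp [hi, hj]
  rw [chartEval_eq_awayEval, chartEval_eq_awayEval,
    ← awayEval_comp_awayMap x _ _ (X_mem_grading K n j) _ rfl _ hij,
    ← awayEval_comp_awayMap x _ _ (X_mem_grading K n i) _ (mul_comm _ _) _ hij,
    CommRingCat.ofHom_comp, CommRingCat.ofHom_comp, Spec.map_comp, Spec.map_comp, Category.assoc,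
    Category.assoc, Proj.SpecMap_awayMap_awayι, Proj.SpecMap_awayMap_awayι]

/-- The single point of `Spec L` lands in some `D₊(X_i)`, so `Q` is given by a ring map `φ`; the
coordinates are the `φ (X_j / X_i)`. That `Q` is a `K`-morphism makes `φ` `K`-linear. -/
lemma exists_isCoordinates (Q : Spec (.of L) ⟶ PSpace K n)
    (hQ : Q ≫ PSpace.toSpec K n = Spec.map (CommRingCat.ofHom (algebraMap K L))) :
    ∃ x, IsCoordinates Q x := by
  have hadj : Algebra.adjoin (grading K n 0)
      (Set.range (MvPolynomial.X : Fin (n + 1) → MvPolynomial (Fin (n + 1)) K)) = ⊤ := by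
    refine eq_top_iff.2 fun f _ => ?_
    induction f using MvPolynomial.induction_on with
    | C a => exact Subalgebra.algebraMap_mem _ (algebraMap K (grading K n 0) a)
    | add p q hp hq => exact add_mem (hp trivial) (hq trivial)
    | mul_X p i hp => exact mul_mem (hp trivial) (Algebra.subset_adjoin ⟨i, rfl⟩)
  have hcov := Proj.iSup_basicOpen_eq_top' (𝒜 := grading K n) (MvPolynomial.X (R := K))
    (fun i => ⟨1, X_mem_grading K n i⟩) hadj
  have hmem : Q (IsLocalRing.closedPoint L) ∈
    ⨆ i, Proj.basicOpen (grading K n) (MvPolynomial.X (R := K) i) := hcov ▸ trivial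
  obtain ⟨i, hi⟩ := TopologicalSpace.Opens.mem_iSup.1 hmem
  have hrange : Set.range Q ⊆ Set.range (Proj.awayι (grading K n) (MvPolynomial.X i)
      (X_mem_grading K n i) one_pos) := by
    rintro _ ⟨z, rfl⟩
    rw [show z = IsLocalRing.closedPoint L from Subsingleton.elim _ _]
    rw [← Proj.opensRange_awayι (grading K n) _ (X_mem_grading K n i) one_pos] at hi
    exact hi
  obtain ⟨φ, hφ⟩ := Spec.map_surjective (IsOpenImmersion.lift _ Q hrange)
  have hQφ : Q = Spec.map φ ≫ Proj.awayι (grading K n) (MvPolynomial.X i)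
      (X_mem_grading K n i) one_pos := by
    rw [hφ, IsOpenImmersion.lift_fac]
  have hK : φ.hom.comp ((HomogeneousLocalization.fromZeroRingHom (grading K n) _).comp
      (algebraMap K (grading K n 0))) = algebraMap K L := by
    rw [hQφ, PSpace.toSpec, Category.assoc, Proj.awayι_toSpecZero_assoc, ← Spec.map_comp,
      ← Spec.map_comp] at hQ
    have := congrArg CommRingCat.Hom.hom (Spec.map_injective hQ)
    simpa [RingHom.comp_assoc] using this
  have hX : dehomogenize K (n := n) i (MvPolynomial.X i) = 1 := by
    rw [dehomogenize_of_mem i 1 _ (by simpa using X_mem_grading K n i)]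
    ext
    simp
  let x : Fin (n + 1) → L := fun j => φ.hom (dehomogenize K i (MvPolynomial.X j))
  have hxi : x i = 1 := by simp [x, hX]
  refine ⟨x, i, by simp [hxi], ?_⟩
  rw [hQφ]
  congr 2
  ext a
  obtain ⟨f, rfl⟩ := dehomogenize_surjective i a
  simp only [CommRingCat.hom_ofHom, chartEval_dehomogenize, hxi, div_one]
  have : φ.hom.comp (dehomogenize K i) =
      (MvPolynomial.aeval x : MvPolynomial (Fin (n + 1)) K →ₐ[K] L).toRingHom := by
    refine MvPolynomial.ringHom_ext (fun a => ?_) (fun j => ?_)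
    · have h := DFunLike.congr_fun hK a
      rw [RingHom.comp_apply, dehomogenize, MvPolynomial.eval₂Hom_C]
      simpa using h
    · simp [x]
  exact DFunLike.congr_fun this f

/-- A point of `ℙⁿ(L)` has coordinates in the closed unit polydisc with one coordinate `1`. -/
lemma exists_normalized_coordinates (w : AbsoluteValue L ℝ) (Q : Spec (.of L) ⟶ PSpace K n)
    (hQ : Q ≫ PSpace.toSpec K n = Spec.map (CommRingCat.ofHom (algebraMap K L))) :
    ∃ (i : Fin (n + 1)) (x : Fin (n + 1) → L) (hi : x i = 1), (∀ j, w (x j) ≤ 1) ∧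
      Q = Spec.map (CommRingCat.ofHom (chartEval (K := K) x i (hi ▸ one_ne_zero))) ≫
        Proj.awayι (grading K n) (MvPolynomial.X i) (X_mem_grading K n i) one_pos := by
  obtain ⟨x, k, hk, hx⟩ := exists_isCoordinates Q hQ
  -- Divide by a coordinate of maximal absolute value; the chart therefore depends on `w`.
  obtain ⟨i, -, hi⟩ := Finset.exists_max_image Finset.univ (fun j => w (x j)) ⟨k, Finset.mem_univ _⟩
  have hpos : 0 < w (x i) := (w.pos hk).trans_le (hi k (Finset.mem_univ _))
  have hi0 : x i ≠ 0 := w.pos_iff.1 hpos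
  refine ⟨i, fun j => x j / x i, div_self hi0, fun j => ?_, ?_⟩
  · rw [map_div₀, div_le_one hpos]
    exact hi j (Finset.mem_univ _)
  · rw [chartEval_div x i hi0, hx, chart_eq_chart x k i hk hi0]

end Coordinates

/-! ### Affine charts of a projective variety -/

section Charts

lemma awayToSection_awayι_appLE {K : Type u} [Field K] {n : ℕ} (i : Fin (n + 1)) :
    Proj.awayToSection (grading K n) (MvPolynomial.X i) ≫
      (Proj.awayι (grading K n) (MvPolynomial.X i) (X_mem_grading K n i) one_pos).appLE
        (Proj.basicOpen (grading K n) (MvPolynomial.X i)) ⊤ (by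
          rw [← Proj.opensRange_awayι (grading K n) _ (X_mem_grading K n i) one_pos]
          simp) = (Scheme.ΓSpecIso _).inv := by
  let ψ := Proj.basicOpenIsoSpec (grading K n) _ (X_mem_grading K n i) one_pos
  have h : ψ.hom.appTop = (Scheme.ΓSpecIso _).hom ≫ Proj.awayToSection (grading K n) _ ≫
      (Proj.basicOpen (grading K n) (MvPolynomial.X i)).topIso.inv :=
    Proj.basicOpenToSpec_app_top (grading K n) (MvPolynomial.X i)
  have h2 : (Proj.awayι (grading K n) (MvPolynomial.X i) (X_mem_grading K n i) one_pos).appLE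
        (Proj.basicOpen (grading K n) (MvPolynomial.X i)) ⊤ (by
          rw [← Proj.opensRange_awayι (grading K n) _ (X_mem_grading K n i) one_pos]
          simp) = (Proj.basicOpen (grading K n) (MvPolynomial.X i)).topIso.inv ≫ ψ.inv.appTop := by
    change (ψ.inv ≫ Scheme.Opens.ι _).appLE _ _ _ = _
    rw [← Scheme.Hom.appLE_comp_appLE _ _ _ ⊤ _ (by simp) (by simp)]
    congr 1
  have h3 : ψ.hom.appTop ≫ ψ.inv.appTop = 𝟙 _ := by
    rw [← Scheme.Hom.comp_appTop, ψ.inv_hom_id, Scheme.Hom.id_appTop]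
  rw [h2, ← cancel_epi (Scheme.ΓSpecIso _).hom, Iso.hom_inv_id, ← h3, h]
  simp only [Category.assoc]

/-- Links the two notions of value at a point: through the local ring, as in `Point.eval`, and
through the coordinate ring of the chart. -/
lemma stalkClosedPointTo_germ_awayToSection {K : Type u} [Field K] {n : ℕ} {L : Type u} [Field L]
    (i : Fin (n + 1))
    (χ : HomogeneousLocalization.Away (grading K n) (MvPolynomial.X i) →+* L)
    (Q : Spec (.of L) ⟶ PSpace K n)
    (hQ : Q = Spec.map (CommRingCat.ofHom χ) ≫
      Proj.awayι (grading K n) (MvPolynomial.X i) (X_mem_grading K n i) one_pos)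
    (h : Q (IsLocalRing.closedPoint L) ∈ Proj.basicOpen (grading K n) (MvPolynomial.X i))
    (a : HomogeneousLocalization.Away (grading K n) (MvPolynomial.X i)) :
    (Scheme.stalkClosedPointTo Q).hom ((PSpace K n).presheaf.germ _ _ h
      ((Proj.awayToSection (grading K n) (MvPolynomial.X i)).hom a)) = χ a := by
  have hle : Proj.awayι (grading K n) (MvPolynomial.X i) (X_mem_grading K n i) one_pos ⁻¹ᵁ
      Proj.basicOpen (grading K n) (MvPolynomial.X i) = ⊤ := by
    rw [← Proj.opensRange_awayι (grading K n) _ (X_mem_grading K n i) one_pos]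
    simp
  subst hQ
  have h1 := Scheme.germ_stalkClosedPointTo (Spec.map (CommRingCat.ofHom χ) ≫
      Proj.awayι (grading K n) (MvPolynomial.X i) (X_mem_grading K n i) one_pos) _ h
  have h2 : Proj.awayToSection (grading K n) (MvPolynomial.X i) ≫
      (PSpace K n).presheaf.germ _ _ h ≫ Scheme.stalkClosedPointTo _ = CommRingCat.ofHom χ := by
    rw [h1]
    have h3 : (Spec.map (CommRingCat.ofHom χ) ≫
        Proj.awayι (grading K n) (MvPolynomial.X i) (X_mem_grading K n i) one_pos).appLE
          (Proj.basicOpen (grading K n) (MvPolynomial.X i)) ⊤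
          (by rw [Scheme.Hom.comp_preimage, hle]; simp) =
        (Proj.awayι (grading K n) (MvPolynomial.X i) (X_mem_grading K n i) one_pos).appLE
          (Proj.basicOpen (grading K n) (MvPolynomial.X i)) ⊤ hle.ge ≫
          (Spec.map (CommRingCat.ofHom χ)).appTop := by
      rw [← Scheme.Hom.appLE_comp_appLE _ _ _ ⊤ _ hle.ge (by simp)]
      congr 1
    have h4 : Proj.awayToSection (grading K n) (MvPolynomial.X i) ≫
        (Spec.map (CommRingCat.ofHom χ) ≫
          Proj.awayι (grading K n) (MvPolynomial.X i) (X_mem_grading K n i) one_pos).appLE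
            (Proj.basicOpen (grading K n) (MvPolynomial.X i)) ⊤
            (by rw [Scheme.Hom.comp_preimage, hle]; simp) ≫ (Scheme.ΓSpecIso (.of L)).hom =
        CommRingCat.ofHom χ := by
      rw [h3, Category.assoc, reassoc_of% (awayToSection_awayι_appLE (K := K) (n := n) i),
        Scheme.ΓSpecIso_naturality, Iso.inv_hom_id_assoc]
    refine Eq.trans ?_ h4
    rw [Scheme.Hom.appLE]
    simp only [Iso.trans_hom, Functor.mapIso_hom, Iso.op_hom, eqToIso.hom, Category.assoc]
    rfl
  exact congrArg (fun φ => φ.hom a) h2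

namespace ProjectiveEmbedding

variable {K : Type u} [Field K] {X : Scheme.{u}} {f : X ⟶ Spec (.of K)} (e : ProjectiveEmbedding f)

instance : IsClosedImmersion e.ι := e.isClosedImmersion

/-- The affine chart `X ∩ D₊(X_i)`. -/
noncomputable def chart (i : Fin (e.n + 1)) : X.Opens :=
  e.ι ⁻¹ᵁ Proj.basicOpen (grading K e.n) (MvPolynomial.X i)

lemma isAffineOpen_chart (i : Fin (e.n + 1)) : IsAffineOpen (e.chart i) :=
  (Proj.isAffineOpen_basicOpen (grading K e.n) _ (X_mem_grading K e.n i) one_pos).preimage e.ι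

/-- The restriction of functions from `D₊(X_i)` to `X ∩ D₊(X_i)`, precomposed with
dehomogenisation. -/
noncomputable def chartFun (i : Fin (e.n + 1)) :
    MvPolynomial (Fin (e.n + 1)) K →+* Γ(X, e.chart i) :=
  (Proj.awayToSection (grading K e.n) (MvPolynomial.X i) ≫ e.ι.app _).hom.comp
    (dehomogenize K i)

/-- A closed immersion is surjective on sections over affine opens. Functions on the chart are thus
polynomials in the `X_j / X_i`, which are bounded on the unit polydisc. -/
lemma chartFun_surjective (i : Fin (e.n + 1)) : Function.Surjective (e.chartFun i) := by
  have h1 : Function.Surjective (e.ι.app (Proj.basicOpen (grading K e.n) (MvPolynomial.X i))) :=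
    Scheme.Hom.app_surjective e.ι _
      (Proj.isAffineOpen_basicOpen (grading K e.n) _ (X_mem_grading K e.n i) one_pos)
  have h2 : Function.Bijective (Proj.awayToSection (grading K e.n) (MvPolynomial.X i)) := by
    rw [← Proj.basicOpenIsoAway_hom (grading K e.n) _ (X_mem_grading K e.n i) one_pos]
    exact ConcreteCategory.bijective_of_isIso _
  exact (h1.comp h2.2).comp (dehomogenize_surjective i)

lemma eval_chartFun {L : Type u} [Field L] [Algebra K L] (P : Spec (.of L) ⟶ X)
    (i : Fin (e.n + 1)) (x : Fin (e.n + 1) → L) (hi : x i ≠ 0)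
    (hP : P ≫ e.ι = Spec.map (CommRingCat.ofHom (chartEval (K := K) x i hi)) ≫
      Proj.awayι (grading K e.n) (MvPolynomial.X i) (X_mem_grading K e.n i) one_pos)
    (h : P (IsLocalRing.closedPoint L) ∈ e.chart i) (g : MvPolynomial (Fin (e.n + 1)) K) :
    (Scheme.stalkClosedPointTo P).hom (X.presheaf.germ _ _ h (e.chartFun i g)) =
      MvPolynomial.aeval (fun j => x j / x i) g := by
  rw [← chartEval_dehomogenize x i hi, ← stalkClosedPointTo_germ_awayToSection i _ _ hP h,
    Scheme.stalkClosedPointTo_comp]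
  refine congrArg (Scheme.stalkClosedPointTo P).hom ?_
  exact (Scheme.Hom.germ_stalkMap_apply e.ι _ _ h _).symm

lemma mem_chart {L : Type u} [Field L] [Algebra K L] (P : Spec (.of L) ⟶ X)
    (i : Fin (e.n + 1)) (x : Fin (e.n + 1) → L) (hi : x i ≠ 0)
    (hP : P ≫ e.ι = Spec.map (CommRingCat.ofHom (chartEval (K := K) x i hi)) ≫
      Proj.awayι (grading K e.n) (MvPolynomial.X i) (X_mem_grading K e.n i) one_pos) :
    P (IsLocalRing.closedPoint L) ∈ e.chart i := by
  change e.ι (P _) ∈ Proj.basicOpen (grading K e.n) (MvPolynomial.X i)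
  have : e.ι (P (IsLocalRing.closedPoint L)) = (P ≫ e.ι) (IsLocalRing.closedPoint L) := rfl
  rw [this, hP, ← Proj.opensRange_awayι (grading K e.n) _
    (X_mem_grading K e.n i) one_pos]
  exact ⟨_, rfl⟩

/-- A homogeneous polynomial vanishing at a point gives a non-unit of the local ring. -/
lemma not_isUnit_germ_chartFun (i : Fin (e.n + 1)) (z : X) (hz : z ∈ e.chart i)
    (g : MvPolynomial (Fin (e.n + 1)) K) (d : ℕ) (hg : g.IsHomogeneous d)
    (hgz : g ∈ (e.ι z).asHomogeneousIdeal) :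
    ¬ IsUnit (X.presheaf.germ _ z hz (e.chartFun i g)) := by
  intro hu
  have hg' : g ∈ grading K e.n (d • 1) := by
    simpa using (MvPolynomial.mem_homogeneousSubmodule d g).2 hg
  have h1 : X.presheaf.germ _ z hz (e.chartFun i g) = (e.ι.stalkMap z).hom
      ((PSpace K e.n).presheaf.germ _ (e.ι z) hz
        ((Proj.awayToSection (grading K e.n) (MvPolynomial.X i)).hom (dehomogenize K i g))) := by
    exact (Scheme.Hom.germ_stalkMap_apply e.ι _ z hz _).symm
  rw [h1] at hu
  have hu2 := isUnit_of_map_unit _ _ hu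
  have h3 := congrArg (fun φ => φ.hom (dehomogenize K i g))
    (ProjectiveSpectrum.Proj.awayToSection_germ (grading K e.n) (MvPolynomial.X i) (e.ι z) hz)
  have hprime : (e.ι z).asHomogeneousIdeal.toIdeal.IsPrime := (e.ι z).isPrime
  -- The germ on `ℙⁿ` becomes `g / X_i ^ d` in the homogeneous localisation at the prime of `e.ι z`;
  -- it is a unit only if `g` avoids that prime.
  have h4 : IsUnit ((HomogeneousLocalization.mapId (grading K e.n)
      (Submonoid.powers_le.mpr hz : Submonoid.powers (MvPolynomial.X i) ≤
        (e.ι z).asHomogeneousIdeal.toIdeal.primeCompl)) (dehomogenize K i g)) := by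
    have h5 := hu2.map (Proj.stalkIso' (grading K e.n) (e.ι z))
    convert h5 using 1
    refine ((RingEquiv.symm_apply_eq _).1 ?_)
    exact h3.symm
  rw [dehomogenize_of_mem i d g hg'] at h4
  exact (IsLocalization.AtPrime.isUnit_mk'_iff (Localization.AtPrime
    (e.ι z).asHomogeneousIdeal.toIdeal) (e.ι z).asHomogeneousIdeal.toIdeal g
      ⟨_, Submonoid.pow_mem (e.ι z).asHomogeneousIdeal.toIdeal.primeCompl hz d⟩).1 (by
        rw [← Localization.mk_eq_mk']
        exact (HomogeneousLocalization.isUnit_iff_isUnit_val _ _ _).2 h4) hgz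

end ProjectiveEmbedding

end Charts

/-! ### The projective version -/

section Poles

/-- A discrete valuation ring has dimension 1, and it contains every nonzero `φ` of nonnegative
order. -/
lemma ord_neg_of_isDiscreteValuationRing {X : Scheme.{u}} [IsIntegral X] [IsLocallyNoetherian X]
    (z : X) [IsDiscreteValuationRing (X.presheaf.stalk z)] (φ : X.functionField)
    (hφ : ¬ ∃ a : X.presheaf.stalk z, algebraMap _ X.functionField a = φ) :
    Order.coheight z = 1 ∧ Scheme.ord φ z < 0 := by
  have hz : Order.coheight z = 1 := by
    have h1 := ringKrullDim_stalk_eq_coheight z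
    rw [IsDiscreteValuationRing.ringKrullDim_eq_one] at h1
    exact_mod_cast h1.symm
  refine ⟨hz, ?_⟩
  have hφ0 : φ ≠ 0 := fun h => hφ ⟨0, by simp [h]⟩
  by_contra! hle
  rw [Scheme.le_ord_iff hz hφ0] at hle
  apply hφ
  have : Ring.KrullDimLE 1 (X.presheaf.stalk z) := krullDimLE_of_coheight_le hz.le
  have h2 : 1 ≤ Ring.ordFrac (X.presheaf.stalk z) φ := hle
  rw [Ring.ordFrac_eq_valuation_inv] at h2
  refine IsDiscreteValuationRing.exists_lift_of_le_one ?_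
  rwa [one_le_inv₀ (by
    rw [zero_lt_iff]
    exact (map_ne_zero _).2 hφ0)] at h2

namespace ProjectiveVariety

variable {K : Type u} [Field K] {V : ProjectiveVariety K}

/-- On a normal variety, a rational function whose denominators on an affine open set all vanish
at a point has a pole there. -/
theorem IsNormal.mem_poleSupport (hV : V.IsNormal) (φ : V.FunctionField) {U : V.X.Opens}
    (hU : IsAffineOpen U) (z : V.X) (hz : z ∈ U)
    (hden : ∀ a b : Γ(V.X, U), algebraMap _ V.FunctionField (V.X.presheaf.germ U z hz b) =
      algebraMap _ V.FunctionField (V.X.presheaf.germ U z hz a) * φ →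
        ¬ IsUnit (V.X.presheaf.germ U z hz a)) :
    z ∈ V.poleSupport φ := by
  have : Nonempty U := ⟨⟨z, hz⟩⟩
  have := functionField_isFractionRing_of_isAffineOpen V.X U hU
  have : IsNoetherianRing Γ(V.X, U) := IsLocallyNoetherian.component_noetherian ⟨U, hU⟩
  let _ := TopCat.Presheaf.algebra_section_stalk V.X.presheaf ⟨z, hz⟩
  have htower := functionField_isScalarTower V.X U ⟨z, hz⟩
  have hloc := hU.isLocalization_stalk ⟨z, hz⟩
  obtain ⟨p, hp, hpq, H⟩ := exists_prime_le_isDiscreteValuationRing (R := Γ(V.X, U)) φ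
    (hU.primeIdealOf ⟨z, hz⟩).asIdeal (by
      rintro a ⟨b, hb⟩
      by_contra ha
      refine hden a b ?_ (IsLocalization.map_units (V.X.presheaf.stalk z)
        (⟨a, ha⟩ : (hU.primeIdealOf ⟨z, hz⟩).asIdeal.primeCompl))
      rwa [Scheme.algebraMap_germ_eq_germToFunctionField,
        Scheme.algebraMap_germ_eq_germToFunctionField])
  -- The prime found inside that of `z` is the generic point of a polar divisor through `z`.
  let x : V.X := hU.fromSpec ⟨p, hp⟩
  have hxU : x ∈ U := by
    have h : x ∈ hU.fromSpec.opensRange := ⟨_, rfl⟩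
    rwa [hU.opensRange_fromSpec] at h
  have hxp : hU.primeIdealOf ⟨x, hxU⟩ = ⟨p, hp⟩ :=
    hU.fromSpec.isOpenEmbedding.injective (hU.fromSpec_primeIdealOf ⟨x, hxU⟩)
  have hxz : x ⤳ z := by
    have h : (⟨p, hp⟩ : PrimeSpectrum Γ(V.X, U)) ⤳ hU.primeIdealOf ⟨z, hz⟩ :=
      (PrimeSpectrum.le_iff_specializes _ _).1 hpq
    have h2 := h.map hU.fromSpec.continuous
    rwa [hU.fromSpec_primeIdealOf] at h2
  let _ := TopCat.Presheaf.algebra_section_stalk V.X.presheaf ⟨x, hxU⟩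
  have htower' := functionField_isScalarTower V.X U ⟨x, hxU⟩
  have hloc' := hU.isLocalization_stalk ⟨x, hxU⟩
  rw [hxp] at hloc'
  have hnorm := hV x
  obtain ⟨hdvr, hreg⟩ := H (V.X.presheaf.stalk x)
  refine Set.mem_biUnion (x := x) (ord_neg_of_isDiscreteValuationRing x φ hreg) ?_
  exact specializes_iff_mem_closure.1 hxz

end ProjectiveVariety

end Poles

/-! ### Ideals of denominators and the estimate on each chart -/

section Projective

namespace ProjectiveVariety

variable {K : Type u} [Field K] {V : ProjectiveVariety K}

/-- The ideal of denominators of a rational function on an open set. -/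
noncomputable def denominators (φ : V.FunctionField) (U : V.X.Opens) [Nonempty U] :
    Ideal Γ(V.X, U) :=
  (LinearMap.range (Algebra.linearMap Γ(V.X, U) V.FunctionField)).comap
    (LinearMap.toSpanSingleton Γ(V.X, U) V.FunctionField φ)

lemma mem_denominators (φ : V.FunctionField) (U : V.X.Opens) [Nonempty U] (b : Γ(V.X, U)) :
    b ∈ denominators φ U ↔
      ∃ a, V.X.germToFunctionField U a = V.X.germToFunctionField U b * φ := by
  rw [denominators, Submodule.mem_comap, LinearMap.mem_range, LinearMap.toSpanSingleton_apply,
    Algebra.smul_def]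
  rfl

/-- A prime containing all denominators is a point of the chart lying in every pole support, hence
in `Y`, where `g` vanishes. -/
lemma IsNormal.chartFun_mem_radical (hV : V.IsNormal) (e : ProjectiveEmbedding V.hom) {r : ℕ}
    (φ : Fin r → V.FunctionField) (i : Fin (e.n + 1)) [Nonempty (e.chart i)]
    (g : MvPolynomial (Fin (e.n + 1)) K) {d : ℕ} (hg : g.IsHomogeneous d)
    (hgY : g ∈ ProjectiveSpectrum.vanishingIdeal (𝒜 := grading K e.n)
      (e.ι '' ⋂ l, V.poleSupport (φ l))) :
    e.chartFun i g ∈ (⨆ l, denominators (φ l) (e.chart i)).radical := by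
  rw [Ideal.radical_eq_sInf, Ideal.mem_sInf]
  rintro q ⟨hle, hq⟩
  have hU := e.isAffineOpen_chart i
  let z : V.X := hU.fromSpec ⟨q, hq⟩
  have hz : z ∈ e.chart i := by
    have h : z ∈ hU.fromSpec.opensRange := ⟨_, rfl⟩
    rwa [hU.opensRange_fromSpec] at h
  have hzq : hU.primeIdealOf ⟨z, hz⟩ = ⟨q, hq⟩ :=
    hU.fromSpec.isOpenEmbedding.injective (hU.fromSpec_primeIdealOf ⟨z, hz⟩)
  let _ := TopCat.Presheaf.algebra_section_stalk V.X.presheaf ⟨z, hz⟩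
  have hloc := hU.isLocalization_stalk ⟨z, hz⟩
  rw [hzq] at hloc
  have hunit : ∀ a, IsUnit (V.X.presheaf.germ _ z hz a) ↔ a ∉ q := fun a =>
    IsLocalization.AtPrime.isUnit_to_map_iff (V.X.presheaf.stalk z) q a
  have hzY : z ∈ ⋂ l, V.poleSupport (φ l) := by
    refine Set.mem_iInter.2 fun l => hV.mem_poleSupport (φ l) hU z hz fun b a hab => ?_
    rw [hunit, not_not]
    refine hle ((le_iSup (fun l => denominators (φ l) (e.chart i)) l) ?_)
    rw [mem_denominators]
    refine ⟨a, ?_⟩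
    rwa [Scheme.algebraMap_germ_eq_germToFunctionField,
      Scheme.algebraMap_germ_eq_germToFunctionField] at hab
  have hgz := (ProjectiveSpectrum.mem_vanishingIdeal _ _).1 hgY _ ⟨z, hzY, rfl⟩
  by_contra hcon
  exact e.not_isUnit_germ_chartFun i z hz g d hg hgz ((hunit _).2 hcon)

/-- A power of the dehomogenisation of `g` is a sum of denominators of the `φ l`. -/
lemma IsNormal.exists_pow_eq_sum (hV : V.IsNormal) (e : ProjectiveEmbedding V.hom) {r : ℕ}
    (φ : Fin r → V.FunctionField) (i : Fin (e.n + 1)) [Nonempty (e.chart i)]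
    (g : MvPolynomial (Fin (e.n + 1)) K) {d : ℕ} (hg : g.IsHomogeneous d)
    (hgY : g ∈ ProjectiveSpectrum.vanishingIdeal (𝒜 := grading K e.n)
      (e.ι '' ⋂ l, V.poleSupport (φ l))) :
    ∃ (N : ℕ) (a b : Fin r → MvPolynomial (Fin (e.n + 1)) K),
      e.chartFun i g ^ N = ∑ l, e.chartFun i (b l) ∧
      ∀ l, V.X.germToFunctionField _ (e.chartFun i (a l)) =
        V.X.germToFunctionField _ (e.chartFun i (b l)) * φ l := by
  obtain ⟨N, hN⟩ := hV.chartFun_mem_radical e φ i g hg hgY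
  obtain ⟨f, hf, hsum⟩ := (Submodule.mem_iSup_iff_exists_finsupp _ _).1 hN
  rw [Finsupp.sum_fintype _ _ (by simp)] at hsum
  choose b hb using fun l => e.chartFun_surjective i (f l)
  choose a' ha' using fun l => (mem_denominators (φ l) (e.chart i) _).1 (hf l)
  choose a ha using fun l => e.chartFun_surjective i (a' l)
  refine ⟨N, a, b, ?_, fun l => ?_⟩
  · simp only [hb]
    exact hsum.symm
  · rw [ha, hb, ha']

/-- Evaluation is a local homomorphism, so `b` is a unit, `φ` is regular at `P`, and its value is
the quotient. -/
lemma Point.logAbs_eq (P : V.Point) (w : Place (AlgebraicClosure K)) (φ : V.FunctionField)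
    (a b : V.X.presheaf.stalk P.pt)
    (hab : algebraMap _ V.FunctionField a = algebraMap _ V.FunctionField b * φ)
    (hb : P.eval b ≠ 0) :
    P.logAbs w φ = w.logAbs (P.eval a / P.eval b) := by
  have hinj := IsFractionRing.injective (V.X.presheaf.stalk P.pt) V.FunctionField
  have hlocal : IsLocalHom P.eval := Scheme.isLocalHom_stalkClosedPointTo' P.hom
  have hbu : IsUnit b := isUnit_of_map_unit P.eval b (isUnit_iff_ne_zero.2 hb)
  obtain ⟨b', hb'⟩ := hbu.exists_right_inv
  have hreg : ∃ a : V.X.presheaf.stalk P.pt, algebraMap _ V.FunctionField a = φ := by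
    refine ⟨a * b', ?_⟩
    rw [map_mul, hab, mul_right_comm, ← map_mul, hb', map_one, one_mul]
  rw [Point.logAbs, dif_pos hreg]
  congr 1
  rw [eq_div_iff hb, ← map_mul]
  congr 1
  apply hinj
  rw [map_mul, hreg.choose_spec, hab, mul_comm]

/-- The assertion of the projective version on one chart. -/
lemma IsNormal.exists_bound_chart [NumberField K] (hV : V.IsNormal) {r : ℕ}
    (φ : Fin r → V.FunctionField) (T : TubularDatum V (⋂ l, V.poleSupport (φ l)))
    (i : Fin (T.emb.n + 1)) :
    ∃ C : Place K → ℝ, IsMBound C ∧ ∀ (w : Place (AlgebraicClosure K)) (P : V.Point)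
      (x : Fin (T.emb.n + 1) → AlgebraicClosure K) (hi : x i = 1), (∀ j, w.abv (x j) ≤ 1) →
      P.hom ≫ T.emb.ι = Spec.map (CommRingCat.ofHom
          (chartEval (K := K) x i (hi ▸ one_ne_zero))) ≫
        Proj.awayι (grading K T.emb.n) (MvPolynomial.X i) (X_mem_grading K T.emb.n i) one_pos →
      (∃ l, P.logAbs w (φ l) ≤ (Real.log (C (w.below K)) : ℝ)) ∨ P ∈ T.nhd w := by
  rcases isEmpty_or_nonempty (T.emb.chart i) with hempty | hne
  · refine ⟨_, isMBound_one, fun w P x hi _ hP => ?_⟩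
    exact hempty.elim ⟨_, T.emb.mem_chart P.hom i x _ hP⟩
  have hgY : ∀ j, T.g j ∈ ProjectiveSpectrum.vanishingIdeal (𝒜 := grading K T.emb.n)
      (T.emb.ι '' ⋂ l, V.poleSupport (φ l)) := fun j => by
    have h : T.g j ∈ Ideal.span (Set.range T.g) := Ideal.subset_span ⟨j, rfl⟩
    rw [T.span_eq] at h
    exact h
  choose N a b hN hab using fun j => hV.exists_pow_eq_sum T.emb φ i (T.g j) (T.homogeneous j) (hgY j)
  obtain ⟨C₀, hC₀, -, hC₀'⟩ := exists_isMBound_le_exp T.c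
  -- The index set varies place, point and normalised coordinates together, so that one
  -- `M_K`-constant serves them all.
  let S := {s : Place (AlgebraicClosure K) × V.Point × (Fin (T.emb.n + 1) → AlgebraicClosure K) //
    (∀ j, s.1.abv (s.2.2 j) ≤ 1) ∧ ∃ hi : s.2.2 i = 1,
      s.2.1.hom ≫ T.emb.ι = Spec.map (CommRingCat.ofHom
          (chartEval (K := K) s.2.2 i (hi ▸ one_ne_zero))) ≫
        Proj.awayι (grading K T.emb.n) (MvPolynomial.X i) (X_mem_grading K T.emb.n i) one_pos}
  have hmem : ∀ s : S, s.1.2.1.pt ∈ T.emb.chart i := fun s =>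
    T.emb.mem_chart s.1.2.1.hom i s.1.2.2 _ s.2.2.2
  have heval : ∀ (s : S) (g : MvPolynomial (Fin (T.emb.n + 1)) K),
      s.1.2.1.eval (V.X.presheaf.germ _ _ (hmem s) (T.emb.chartFun i g)) =
        MvPolynomial.aeval s.1.2.2 g := fun s g => by
    have h := T.emb.eval_chartFun s.1.2.1.hom i s.1.2.2 _ s.2.2.2 (hmem s) g
    simp only [s.2.2.1, div_one] at h
    exact h
  have hbdd : ∀ p : MvPolynomial (Fin (T.emb.n + 1)) K,
      IsMBddFamily K (fun s : S => s.1.1) (fun s => MvPolynomial.aeval s.1.2.2 p) :=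
    isMBddFamily_aeval fun j => isMBddFamily_of_le_one fun s => s.2.1 j
  obtain ⟨C, hC, hd⟩ := exists_bound_of_pow_eq_sum (K := K) (pl := fun s : S => s.1.1)
    (fun j s => MvPolynomial.aeval s.1.2.2 (T.g j)) N (fun _ _ _ => 1)
    (fun j l s => MvPolynomial.aeval s.1.2.2 (b j l))
    (fun _ _ => isMBddFamily_of_le_one fun s => (map_one s.1.1.abv).le)
    (fun j s => by
      simp only [one_mul, ← heval, ← map_pow, ← map_sum, hN]) hC₀
  choose D hD hD' using fun k : Fin T.s × Fin r => hbdd (a k.1 k.2)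
  -- `C` bounds `1 / |b j l|` and the product of the `D` bounds every `|a j l|`, so their product
  -- bounds the quotient.
  have hDC := hC.mul (IsMBound.prod Finset.univ hD)
  refine ⟨_, hDC, fun w P x hi hx hP => ?_⟩
  let s : S := ⟨(w, P, x), hx, hi, hP⟩
  refine (hd s).imp ?_ ?_
  · rintro ⟨j, l, hjl⟩
    refine ⟨l, ?_⟩
    have hCpos := hC.pos (w.below K)
    have hbpos : 0 < w.abv (MvPolynomial.aeval x (b j l)) :=
      (inv_pos.2 hCpos).trans_le hjl
    have hb0 : P.eval (V.X.presheaf.germ _ _ (hmem s) (T.emb.chartFun i (b j l))) ≠ 0 := by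
      rw [heval s]
      exact w.abv.pos_iff.1 hbpos
    rw [P.logAbs_eq w (φ l) (V.X.presheaf.germ _ _ (hmem s) (T.emb.chartFun i (a j l)))
      (V.X.presheaf.germ _ _ (hmem s) (T.emb.chartFun i (b j l)))
      (by rw [Scheme.algebraMap_germ_eq_germToFunctionField,
            Scheme.algebraMap_germ_eq_germToFunctionField, hab]) hb0,
      Place.logAbs_le_iff, Real.exp_log (hDC.pos _), heval s, heval s, map_div₀,
      div_le_iff₀ hbpos]
    have h1 : w.abv (MvPolynomial.aeval x (a j l)) ≤ ∏ k, D k (w.below K) :=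
      (hD' (j, l) s).trans (IsMBound.le_prod hD (j, l) _)
    have h2 : 1 ≤ C (w.below K) * w.abv (MvPolynomial.aeval x (b j l)) :=
      (inv_le_iff_one_le_mul₀' hCpos).1 hjl
    have h3 := (IsMBound.prod Finset.univ hD).pos (w.below K)
    calc w.abv (MvPolynomial.aeval x (a j l)) ≤ ∏ k, D k (w.below K) := h1
      _ ≤ (∏ k, D k (w.below K)) * (C (w.below K) * w.abv (MvPolynomial.aeval x (b j l))) :=
        le_mul_of_one_le_right h3.le h2
      _ = _ := by ring
  · intro hsmall
    refine ⟨x, ⟨i, hi ▸ one_ne_zero, hP⟩, fun j => ?_⟩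
    have hsup : ⨆ k, w.abv (x k) = 1 :=
      le_antisymm (ciSup_le hx)
        (by simpa [hi] using le_ciSup (Set.finite_range fun k => w.abv (x k)).bddAbove i)
    rw [hsup, Real.log_one, mul_zero, zero_add, Place.logAbs_lt_iff]
    exact (hsmall j).trans_le (hC₀' _)

/-- For each `w`, every point has normalised coordinates in one of the finitely many charts; the
product of the chart constants works for all. -/
theorem IsNormal.dichotomy [NumberField K] (hV : V.IsNormal) {r : ℕ}
    (φ : Fin r → V.FunctionField) (W : Place (AlgebraicClosure K) → Set V.Point)
    (hW : IsTubularNeighbourhood V (⋂ l, V.poleSupport (φ l)) W) :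
    ∃ c : MConstant K, ∀ (w : Place (AlgebraicClosure K)) (P : V.Point),
      (⨅ l, P.logAbs w (φ l)) ≤ ((c (w.below K) : ℝ) : EReal) ∨ P ∈ W w := by
  obtain ⟨T, rfl⟩ := hW
  choose C hC hd using hV.exists_bound_chart φ T
  obtain ⟨c, hc⟩ := (IsMBound.prod Finset.univ hC).exists_exp_eq
  refine ⟨c, fun w P => ?_⟩
  obtain ⟨i, x, hi, hx, hP⟩ := exists_normalized_coordinates w.abv (P.hom ≫ T.emb.ι)
    (by rw [Category.assoc, T.emb.comp_eq, P.comp_eq])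
  refine (hd i w P x hi hx hP).imp_left ?_
  rintro ⟨l, hl⟩
  refine (iInf_le _ l).trans (hl.trans ?_)
  rw [EReal.coe_le_coe_iff, Real.log_le_iff_le_exp ((hC i).pos _), hc]
  exact IsMBound.le_prod hC i _

end ProjectiveVariety

end Projective

end TubularRunge

theorem mainTheorem5 (K : Type u) [Field K] [NumberField K] :
    -- affine version
    (∀ (A : Type v) [CommRing A] [Algebra K A] [Algebra.FiniteType K A]
      (r : ℕ) (Y : Fin r → Set (PrimeSpectrum A)) (_ : ∀ l, IsClosed (Y l))
      (s : Fin r → ℕ) (g : (l : Fin r) → Fin (s l) → A)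
      (_ : ∀ l, Ideal.span (Set.range (g l)) = PrimeSpectrum.vanishingIdeal (Y l))
      (t : ℕ) (h : Fin t → A)
      (_ : Ideal.span (Set.range h) = PrimeSpectrum.vanishingIdeal (⋂ l, Y l))
      (E : Set (TubularRunge.AffinePoint K A × TubularRunge.Place (AlgebraicClosure K)))
      (_ : TubularRunge.IsMBounded E) (c₀ : TubularRunge.MConstant K),
      ∃ c : TubularRunge.MConstant K,
        ∀ (P : TubularRunge.AffinePoint K A) (w : TubularRunge.Place (AlgebraicClosure K)),
          (P, w) ∈ E →
          ((c (w.below K) : ℝ) : EReal) ≤ (⨆ l, ⨆ j, w.logAbs (P (g l j))) ∨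
            (⨆ j, w.logAbs (P (h j))) < ((c₀ (w.below K) : ℝ) : EReal)) ∧
    -- projective version
    (∀ (X : TubularRunge.ProjectiveVariety K) (_ : X.IsNormal)
      (r : ℕ) (φ : Fin r → X.FunctionField)
      (V : TubularRunge.Place (AlgebraicClosure K) → Set X.Point)
      (_ : TubularRunge.IsTubularNeighbourhood X (⋂ l, X.poleSupport (φ l)) V),
      ∃ c : TubularRunge.MConstant K,
        ∀ (w : TubularRunge.Place (AlgebraicClosure K)) (P : X.Point),
          (⨅ l, P.logAbs w (φ l)) ≤ ((c (w.below K) : ℝ) : EReal) ∨ P ∈ V w) := by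
  exact ⟨fun A _ _ _ r Y hY s g hg t h hh E hE c₀ =>
    TubularRunge.affine_dichotomy r Y hY s g hg t h hh E hE c₀,
    fun X hX r φ V hV => TubularRunge.ProjectiveVariety.IsNormal.dichotomy hX φ V hV⟩
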